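/- **Proposition (Transience of the walker).** A state is a pair $(T,x)$, where $T$ is a locally finite tree (every vertex has finite degree), finite or infinite, with vertex set $V(T)\subset\mathbb{N}$ such that $\mathbb{N}\setminus V(T)$ is infinite, and $x\in V(T)$. The set of states carries the trace of the product $\sigma$-algebra, a state being described by the indicators of its vertices and edges and by $x$. For $p\in(0,1]$ the Bernoulli growth random walk (BGRW) with parameter $p$ is the Markov chain $(T_n,X_n)_{n\ge 0}$ on the set of states whose transition kernel $K_p$ is as follows. From $(T,x)$: 1. let $m=\min(\mathbb{N}\setminus V(T))$; with probability $p$ let $T'$ be $T$ with the new vertex $m$ and the new edge $\{m,x\}$ added, and with probability $1-p$ let $T'=T$; 2. conditionally on step 1, let $x'$ be a uniformly chosen neighbour of $x$ in $T'$ (if $x$ has no neighbour in $T'$, that is, if $T'$ has a single vertex, let $x'=x$). The new state is $(T',x')$. Let $\mathbb{P}_{T_0,x_0,p}$ denote the law of the chain started from $(T_0,x_0)$, and let $\mathrm{dist}_T$ denote the graph distance in $T$. For every $p\in(0,1]$ there is a constant $c>0$, depending on $p$ only, such that for every state $(T_0,x_0)$ and every vertex $\mathrm{root}\in V(T_0)$,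 $$\liminf_{n\to\infty}\frac{\mathrm{dist}_{T_n}(X_n,\mathrm{root})}{n}\ \ge\ c\qquad \mathbb{P}_{T_0,x_0,p}\text{-almost surely.}$$ -/

import Mathlib

open Filter MeasureTheory ProbabilityTheory SimpleGraph
open scoped ENNReal

noncomputable section

namespace BGRW

/-- A state `(T, x)` of the Bernoulli growth random walk: a locally finite tree `T` whose vertex
set is a subset of `ℕ` with infinite complement, together with a vertex `x` of `T`, the position
of the walker. The tree is a subgraph of the complete graph on `ℕ`. -/
@[ext]
structure State where
  /-- the tree `T` -/
  tree : (⊤ : SimpleGraph ℕ).Subgraph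
  /-- the position `x` of the walker -/
  walker : ℕ
  isTree : tree.coe.IsTree
  locallyFinite : ∀ v, (tree.neighborSet v).Finite
  infinite_compl : (tree.vertsᶜ).Infinite
  walker_mem : walker ∈ tree.verts

namespace State

/-- The description of a state by the indicators of its vertices and of its edges and by the
position of the walker. -/
def code (s : State) : (ℕ → Prop) × (ℕ → ℕ → Prop) × ℕ :=
  (fun v => v ∈ s.tree.verts, fun u v => s.tree.Adj u v, s.walker)

/-- The `σ`-algebra on the set of states is the trace of the product `σ`-algebra. -/
instance : MeasurableSpace State := MeasurableSpace.comap code inferInstance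

/-- The graph distance in the tree of the state `s` between the vertices `u` and `v`. -/
def dist (s : State) (u v : ℕ) : ℕ := s.tree.spanningCoe.dist u v

/-- The smallest natural number that is not a vertex of the tree. -/
def newVertex (s : State) : ℕ := sInf (s.tree.vertsᶜ)

lemma newVertex_notMem (s : State) : s.newVertex ∉ s.tree.verts :=
  Nat.sInf_mem s.infinite_compl.nonempty

lemma walker_adj_newVertex (s : State) : (⊤ : SimpleGraph ℕ).Adj s.walker s.newVertex := by
  rw [top_adj]
  intro h
  exact s.newVertex_notMem (h ▸ s.walker_mem)

/-- The tree with the new vertex attached to the position of the walker. -/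
def grownTree (s : State) : (⊤ : SimpleGraph ℕ).Subgraph :=
  s.tree ⊔ (⊤ : SimpleGraph ℕ).subgraphOfAdj s.walker_adj_newVertex

lemma mem_verts_grownTree (s : State) (v : ℕ) :
    v ∈ s.grownTree.verts ↔ v ∈ s.tree.verts ∨ v = s.newVertex := by
  have := s.walker_mem
  simp only [grownTree, Subgraph.verts_sup, subgraphOfAdj_verts, Set.mem_union,
    Set.mem_insert_iff, Set.mem_singleton_iff]
  constructor
  · rintro (h | h | h)
    · exact Or.inl h
    · exact Or.inl (h ▸ this)
    · exact Or.inr h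
  · tauto

lemma adj_grownTree (s : State) (u v : ℕ) :
    s.grownTree.Adj u v ↔ s.tree.Adj u v ∨ (u = s.walker ∧ v = s.newVertex) ∨
      (u = s.newVertex ∧ v = s.walker) := by
  simp only [grownTree, Subgraph.sup_adj, subgraphOfAdj_adj, Sym2.eq_iff]
  tauto

lemma isAcyclic_spanningCoe (T : (⊤ : SimpleGraph ℕ).Subgraph) (h : T.coe.IsAcyclic) :
    T.spanningCoe.IsAcyclic := by
  rw [isAcyclic_iff_forall_adj_isBridge] at h ⊢
  intro u v huv
  rw [Subgraph.spanningCoe_adj] at huv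
  have h1 := h (v := ⟨u, T.edge_vert huv⟩) (w := ⟨v, T.edge_vert huv.symm⟩) huv
  rw [isBridge_iff] at h1 ⊢
  intro hr
  apply h1
  rw [reachable_iff_reflTransGen] at hr
  have key : ∀ w, Relation.ReflTransGen (T.spanningCoe.deleteEdges {s(u, v)}).Adj u w →
      ∃ hw : w ∈ T.verts, (T.coe.deleteEdges
        {s(⟨u, T.edge_vert huv⟩, ⟨v, T.edge_vert huv.symm⟩)}).Reachable
          ⟨u, T.edge_vert huv⟩ ⟨w, hw⟩ := by
    intro w hw
    induction hw with
    | refl => exact ⟨T.edge_vert huv, Reachable.refl _⟩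
    | tail _ hab ih =>
      obtain ⟨hb, hreach⟩ := ih
      rw [deleteEdges_adj, Subgraph.spanningCoe_adj] at hab
      refine ⟨T.edge_vert hab.1.symm, hreach.trans (Adj.reachable ?_)⟩
      rw [deleteEdges_adj]
      refine ⟨hab.1, fun hh => hab.2 ?_⟩
      simp only [Set.mem_singleton_iff, Sym2.eq_iff, Subtype.mk.injEq] at hh ⊢
      exact hh
  exact (key v hr).2

lemma isTree_grownTree (s : State) : s.grownTree.coe.IsTree := by
  constructor
  · have h1 : s.tree.Preconnected := ⟨s.isTree.1.preconnected⟩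
    have h2 := (Subgraph.subgraphOfAdj_connected s.walker_adj_newVertex).preconnected
    have h3 := Subgraph.connected_sup h1 h2 ⟨s.walker, s.walker_mem, by simp⟩
    exact h3.coe
  · have h1 := isAcyclic_spanningCoe _ s.isTree.2
    have h2 : s.grownTree.spanningCoe = s.tree.spanningCoe ⊔ edge s.walker s.newVertex := by
      ext u v
      have := s.walker_adj_newVertex.ne
      simp only [Subgraph.spanningCoe_adj, adj_grownTree, sup_adj, edge_adj]
      grind
    have h3 : ¬ s.tree.spanningCoe.Reachable s.walker s.newVertex := by
      apply not_reachable_of_neighborSet_right_eq_empty s.walker_adj_newVertex.ne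
      ext v
      simp only [mem_neighborSet, Subgraph.spanningCoe_adj, Set.mem_empty_iff_false, iff_false]
      exact fun h => s.newVertex_notMem (s.tree.edge_vert h)
    have h4 : s.grownTree.spanningCoe.IsAcyclic := h2 ▸ h1.sup_edge_of_not_reachable h3
    exact h4.comap ⟨Subtype.val, fun h => h⟩ Subtype.val_injective

/-- Growth: the least unused natural number becomes a new leaf attached to the walker's
position. -/
def grow (s : State) : State where
  tree := s.grownTree
  walker := s.walker
  isTree := s.isTree_grownTree
  locallyFinite v := by
    refine ((s.locallyFinite v).union (Set.toFinite {s.newVertex, s.walker})).subset ?_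
    intro w hw
    have := (s.adj_grownTree v w).1 hw
    simp only [Set.mem_union, Set.mem_insert_iff, Set.mem_singleton_iff]
    rcases this with h | h | h
    · exact Or.inl h
    · exact Or.inr (Or.inl h.2)
    · exact Or.inr (Or.inr h.2)
  infinite_compl := by
    refine (s.infinite_compl.sdiff (Set.finite_singleton s.newVertex)).mono ?_
    intro v hv hv'
    rcases (s.mem_verts_grownTree v).1 hv' with h | h
    · exact hv.1 h
    · exact hv.2 h
  walker_mem := (s.mem_verts_grownTree _).2 (Or.inl s.walker_mem)

open Classical in
/-- Displacement of the walker to the vertex `y` (used only for vertices `y` of the tree). -/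
def moveTo (s : State) (y : ℕ) : State :=
  if hy : y ∈ s.tree.verts then { s with walker := y, walker_mem := hy } else s

open Classical in
/-- The possible positions after one step of the walker: the neighbours of its position, or the
position itself in the degenerate case of a tree with a single vertex. -/
def targets (s : State) : Set ℕ :=
  if (s.tree.neighborSet s.walker).Nonempty then s.tree.neighborSet s.walker else {s.walker}

lemma targets_finite (s : State) : s.targets.Finite := by
  unfold targets
  split_ifs
  · exact s.locallyFinite _
  · exact Set.finite_singleton _

lemma targets_nonempty (s : State) : s.targets.Nonempty := by
  unfold targets
  split_ifs with h
  · exact h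
  · exact Set.singleton_nonempty _

/-! Measurability of the coordinates of a state and of the maps above. -/

lemma measurable_code : Measurable code := comap_measurable _

lemma measurable_walker : Measurable walker :=
  measurable_snd.comp (measurable_snd.comp measurable_code)

lemma measurable_mem (v : ℕ) : Measurable fun s : State => v ∈ s.tree.verts :=
  (measurable_pi_apply v).comp (measurable_fst.comp measurable_code)

lemma measurable_adj (u v : ℕ) : Measurable fun s : State => s.tree.Adj u v :=
  (measurable_pi_apply v).comp ((measurable_pi_apply u).comp
    (measurable_fst.comp (measurable_snd.comp measurable_code)))

lemma measurable_of_coords {α : Type*} [MeasurableSpace α] {f : α → State}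
    (h1 : ∀ v, Measurable fun a => v ∈ (f a).tree.verts)
    (h2 : ∀ u v, Measurable fun a => (f a).tree.Adj u v)
    (h3 : Measurable fun a => (f a).walker) : Measurable f := by
  rw [measurable_comap_iff]
  exact (measurable_pi_lambda _ h1).prodMk
    ((measurable_pi_lambda _ fun u => measurable_pi_lambda _ (h2 u)).prodMk h3)

lemma measurable_newVertex : Measurable newVertex := by
  refine measurable_to_countable' fun k => ?_
  have : newVertex ⁻¹' {k} = {s : State | k ∉ s.tree.verts ∧ ∀ j, j < k → j ∈ s.tree.verts} := by
    ext s
    simp only [Set.mem_preimage, Set.mem_singleton_iff, Set.mem_ofPred_eq]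
    constructor
    · rintro rfl
      refine ⟨s.newVertex_notMem, fun j hj => ?_⟩
      by_contra h
      exact Nat.notMem_of_lt_sInf hj h
    · rintro ⟨h1, h2⟩
      refine le_antisymm (Nat.sInf_le h1) ?_
      by_contra h
      exact s.newVertex_notMem (h2 _ (not_le.1 h))
  rw [this]
  refine measurableSet_setOfPred.2 ((measurable_mem k).not.and ?_)
  exact Measurable.forall fun j => measurable_const.imp (measurable_mem j)

lemma measurable_eq_walker (u : ℕ) : Measurable fun s : State => u = s.walker :=
  measurableSet_setOfPred.1 (measurableSet_eq_fun measurable_const measurable_walker)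

lemma measurable_eq_newVertex (u : ℕ) : Measurable fun s : State => u = s.newVertex :=
  measurableSet_setOfPred.1 (measurableSet_eq_fun measurable_const measurable_newVertex)

lemma measurable_grow : Measurable grow := by
  refine measurable_of_coords (fun v => ?_) (fun u v => ?_) measurable_walker
  · simp only [grow, mem_verts_grownTree]
    exact (measurable_mem v).or (measurable_eq_newVertex v)
  · simp only [grow, adj_grownTree]
    exact (measurable_adj u v).or
      (((measurable_eq_walker u).and (measurable_eq_newVertex v)).or
        ((measurable_eq_newVertex u).and (measurable_eq_walker v)))

lemma tree_moveTo (s : State) (y : ℕ) : (s.moveTo y).tree = s.tree := by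
  unfold moveTo
  split_ifs <;> rfl

open Classical in
lemma walker_moveTo (s : State) (y : ℕ) :
    (s.moveTo y).walker = if y ∈ s.tree.verts then y else s.walker := by
  unfold moveTo
  split_ifs <;> rfl

lemma measurable_moveTo (y : ℕ) : Measurable fun s : State => s.moveTo y := by
  refine measurable_of_coords (fun v => ?_) (fun u v => ?_) ?_
  · simp only [tree_moveTo]
    exact measurable_mem v
  · simp only [tree_moveTo]
    exact measurable_adj u v
  · simp only [walker_moveTo]
    exact Measurable.ite (measurableSet_setOfPred.2 (measurable_mem y)) measurable_const
      measurable_walker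

lemma measurable_adj_walker (y : ℕ) : Measurable fun s : State => s.tree.Adj s.walker y := by
  have : (fun s : State => s.tree.Adj s.walker y) =
      fun s => ∃ x, x = s.walker ∧ s.tree.Adj x y := by
    ext s
    simp
  rw [this]
  exact Measurable.exists fun x => (measurable_eq_walker x).and (measurable_adj x y)

lemma measurableSet_mem_targets (y : ℕ) : MeasurableSet {s : State | y ∈ s.targets} := by
  have : (fun s : State => y ∈ s.targets) = fun s =>
      s.tree.Adj s.walker y ∨ ((∀ z, ¬ s.tree.Adj s.walker z) ∧ y = s.walker) := by
    ext s
    unfold targets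
    split_ifs with h
    · obtain ⟨z, hz⟩ := h
      simp only [Subgraph.mem_neighborSet] at hz ⊢
      constructor
      · exact Or.inl
      · rintro (h | h)
        · exact h
        · exact absurd hz (h.1 z)
    · rw [Set.not_nonempty_iff_eq_empty, Set.eq_empty_iff_forall_notMem] at h
      simp only [Subgraph.mem_neighborSet] at h
      simp [h]
  rw [measurableSet_setOfPred, this]
  exact (measurable_adj_walker y).or
    ((Measurable.forall fun z => (measurable_adj_walker z).not).and (measurable_eq_walker y))

lemma measurable_count {B : State → Set ℕ} (hB : ∀ y, MeasurableSet {s | y ∈ B s}) :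
    Measurable fun s => Measure.count (B s) := by
  have : (fun s => Measure.count (B s)) =
      fun s => ∑' y, {s | y ∈ B s}.indicator (fun _ => (1 : ℝ≥0∞)) s := by
    ext s
    rw [Measure.count, Measure.sum_apply _ (Set.to_countable _).measurableSet]
    refine tsum_congr fun y => ?_
    rw [Measure.dirac_apply' _ (Set.to_countable _).measurableSet]
    rfl
  rw [this]
  exact Measurable.tsum fun y => measurable_const.indicator (hB y)

end State

/-- First half of a step: with probability `p` a new leaf is attached to the walker's position,
and with probability `1 - p` nothing happens. -/
def growKernel (p : unitInterval) : Kernel State State where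
  toFun s := ENNReal.ofReal p • Measure.dirac s.grow + ENNReal.ofReal (1 - p) • Measure.dirac s
  measurable' := by
    refine Measure.measurable_of_measurable_coe _ fun A hA => ?_
    simp only [Measure.add_apply, Measure.smul_apply, smul_eq_mul]
    refine (Measurable.const_mul ?_ _).add (Measurable.const_mul ?_ _)
    · exact ((Measure.measurable_coe hA).comp Measure.measurable_dirac).comp State.measurable_grow
    · exact (Measure.measurable_coe hA).comp Measure.measurable_dirac

instance (p : unitInterval) : IsMarkovKernel (growKernel p) := by
  refine ⟨fun s => ⟨?_⟩⟩
  change (ENNReal.ofReal p • Measure.dirac s.grow +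
    ENNReal.ofReal (1 - p) • Measure.dirac s) Set.univ = 1
  simp only [Measure.add_apply, Measure.smul_apply, smul_eq_mul, measure_univ, mul_one]
  rw [← ENNReal.ofReal_add p.2.1 (sub_nonneg.2 p.2.2)]
  simp

/-- Second half of a step: the walker moves to a uniformly chosen neighbour of its position (and
stays put if the tree has a single vertex). -/
def jumpKernel : Kernel State State where
  toFun s := (uniformOn s.targets).map s.moveTo
  measurable' := by
    refine Measure.measurable_of_measurable_coe _ fun A hA => ?_
    have h : ∀ s : State, (uniformOn s.targets).map s.moveTo A =
        (Measure.count s.targets)⁻¹ * Measure.count (s.targets ∩ s.moveTo ⁻¹' A) := by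
      intro s
      rw [Measure.map_apply (measurable_of_countable _) hA, uniformOn,
        cond_apply (Set.to_countable _).measurableSet]
    simp only [h]
    refine (State.measurable_count State.measurableSet_mem_targets).inv.mul
      (State.measurable_count fun y => ?_)
    exact (State.measurableSet_mem_targets y).inter (State.measurable_moveTo y hA)

instance : IsMarkovKernel jumpKernel := by
  refine ⟨fun s => ?_⟩
  change IsProbabilityMeasure ((uniformOn s.targets).map s.moveTo)
  have := isProbabilityMeasure_uniformOn s.targets_finite s.targets_nonempty
  exact Measure.isProbabilityMeasure_map (measurable_of_countable _).aemeasurable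

/-- The transition kernel `K_p` of the Bernoulli growth random walk with parameter `p`: first the
tree may grow at the walker's position, then the walker takes one step on the current tree. -/
def stepKernel (p : unitInterval) : Kernel State State := jumpKernel ∘ₖ growKernel p

instance (p : unitInterval) : IsMarkovKernel (stepKernel p) := by
  unfold stepKernel
  infer_instance

/-- The law on trajectories `(T_n, X_n)_{n ≥ 0}` of the Bernoulli growth random walk with
parameter `p` started from the state `s`: the law of the Markov chain with transition kernel
`K_p` and initial law the point mass at `s`. -/
def law (p : unitInterval) (s : State) : Measure (ℕ → State) :=
  Kernel.trajMeasure (X := fun _ => State) (Measure.dirac s) fun n =>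
    (stepKernel p).comap (fun h => h ⟨n, Finset.mem_Iic.2 le_rfl⟩) (measurable_pi_apply _)

instance (p : unitInterval) (s : State) : IsProbabilityMeasure (law p s) := by
  unfold law
  infer_instance

end BGRW

end

/-!
Let `r` bound from below the probability that one of the first `M` visits to a new vertex `v`
never ends. During the first `b` of these visits about `p * b` children are born. After that the
walker leaves `v` to a given child as often as to the parent of `v`, so that each child is entered
`M` times before the parent is entered `M - b` more times with the probability `f` that a fair
coin shows `M` heads before `M - b` tails. By induction on the time horizon a visit to a child
entered so often never ends with probability at least `r`. As `b * r ≤ 1`, all `M` visits to `v`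
end with probability at most `1 - r / 2 * f * (p * b)`, hence at most `1 - r` if
`2 ≤ f * (p * b)`. As `f` tends to `1 / 2` when `M` is much larger than `b ^ 2`, the induction
closes, with `r = 1 / b`, for large `b`, and `r` depends on `p` only.

Consequently the walker escapes from every level with a probability bounded from below. For `a`
close to `1` the function `V(x) = ∑ j, a ^ j * P_x(level j is reached)` is then comparable to
`a ^ level x`, and its expectation decreases by a constant factor in each step. Hence
`E[a ^ level (X n)]` decays exponentially, and Markov's inequality together with the lemma of Borel
and Cantelli bounds the speed from below.
-/

noncomputable section

namespace BGRW

section MarkovChain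

variable {S : Type*} [MeasurableSpace S]

/-- The law of the Markov chain with transition kernel `κ` started from `x`, on the space of
trajectories. -/
def markovLaw (κ : Kernel S S) [IsMarkovKernel κ] (x : S) : Measure (ℕ → S) :=
  Kernel.trajMeasure (X := fun _ => S) (Measure.dirac x) fun n =>
    κ.comap (fun h => h ⟨n, Finset.mem_Iic.2 le_rfl⟩) (measurable_pi_apply _)

lemma map_eval_zero_markovLaw (κ : Kernel S S) [IsMarkovKernel κ] (x : S) :
    (markovLaw κ x).map (fun ω => ω 0) = Measure.dirac x := by
  have hrestrict : (markovLaw κ x).map (Preorder.frestrictLe 0) =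
      (Measure.dirac x).map (MeasurableEquiv.piUnique fun _ : Finset.Iic 0 => S).symm := by
    rw [markovLaw, Kernel.trajMeasure, Measure.map_comp _ _ (by fun_prop),
      Kernel.traj_map_frestrictLe, Kernel.partialTraj_self, Measure.id_comp]
  have heval : (markovLaw κ x).map (fun ω => ω 0) =
      ((markovLaw κ x).map (Preorder.frestrictLe 0)).map
        fun h : (i : Finset.Iic 0) → S => h ⟨0, by simp⟩ := by
    rw [Measure.map_map (by fun_prop) (by fun_prop)]
    rfl
  rw [heval, hrestrict, Measure.map_map (by fun_prop) (by fun_prop)]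
  exact Measure.map_id

lemma map_eval_succ_markovLaw (κ : Kernel S S) [IsMarkovKernel κ] (x : S) (n : ℕ) :
    (markovLaw κ x).map (fun ω => ω (n + 1)) = κ ∘ₘ (markovLaw κ x).map fun ω => ω n := by
  have hpair := Kernel.map_frestrictLe_trajMeasure_compProd_eq_map_trajMeasure (X := fun _ => S)
    (μ₀ := Measure.dirac x) (κ := fun n => κ.comap
      (fun h => h ⟨n, Finset.mem_Iic.2 le_rfl⟩) (measurable_pi_apply _)) (a := n)
  replace hpair := congrArg Measure.snd hpair
  rw [Measure.snd_compProd, ← Kernel.comp_deterministic_eq_comap, ← Measure.comp_assoc,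
    Measure.deterministic_comp_eq_map, Measure.map_map (by fun_prop) (by fun_prop),
    Measure.snd, Measure.map_map (by fun_prop) (by fun_prop)] at hpair
  exact hpair.symm

lemma map_eval_markovLaw (κ : Kernel S S) [IsMarkovKernel κ] (x : S) (n : ℕ) :
    (markovLaw κ x).map (fun ω => ω n) = (κ ^ n) x := by
  induction n with
  | zero => rw [map_eval_zero_markovLaw, pow_zero]; rfl
  | succ n ih => rw [map_eval_succ_markovLaw, ih, pow_succ']; rfl

lemma lintegral_pow_le_of_drift {κ : Kernel S S} {G : Set S} {V : S → ℝ≥0∞} {r : ℝ≥0∞}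
    (hV : Measurable V) (hG : ∀ x ∈ G, ∀ᵐ y ∂κ x, y ∈ G)
    (hdrift : ∀ x ∈ G, ∫⁻ y, V y ∂κ x ≤ r * V x) (n : ℕ) {x : S} (hx : x ∈ G) :
    ∫⁻ y, V y ∂(κ ^ n) x ≤ r ^ n * V x := by
  induction n generalizing x with
  | zero =>
    rw [pow_zero, pow_zero, one_mul]
    exact (lintegral_dirac' x hV).le
  | succ n ih =>
    calc ∫⁻ y, V y ∂(κ ^ (n + 1)) x = ∫⁻ y, ∫⁻ z, V z ∂(κ ^ n) y ∂κ x := by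
          rw [pow_succ]
          exact Kernel.lintegral_comp _ _ _ hV
      _ ≤ ∫⁻ y, r ^ n * V y ∂κ x := lintegral_mono_ae ((hG x hx).mono fun y => ih)
      _ = r ^ n * ∫⁻ y, V y ∂κ x := lintegral_const_mul _ hV
      _ ≤ r ^ n * (r * V x) := by gcongr; exact hdrift x hx
      _ = r ^ (n + 1) * V x := by rw [pow_succ, mul_assoc]

open Classical in
/-- The probability that the Markov chain with transition kernel `κ` started from `x` visits the
set `A` at one of the times `0, …, n`. -/
def hitProb (κ : Kernel S S) (A : Set S) : ℕ → S → ℝ≥0∞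
  | 0, x => if x ∈ A then 1 else 0
  | n + 1, x => if x ∈ A then 1 else ∫⁻ y, hitProb κ A n y ∂κ x

/-- The probability that the Markov chain with transition kernel `κ` started from `x` ever visits
the set `A`. -/
def everHitProb (κ : Kernel S S) (A : Set S) (x : S) : ℝ≥0∞ := ⨆ n, hitProb κ A n x

variable {κ : Kernel S S} {A : Set S} {x : S}

lemma measurable_hitProb (hA : MeasurableSet A) (n : ℕ) : Measurable (hitProb κ A n) := by
  induction n with
  | zero => exact Measurable.ite hA measurable_const measurable_const
  | succ n ih => exact Measurable.ite hA measurable_const ih.lintegral_kernel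

lemma measurable_everHitProb (hA : MeasurableSet A) : Measurable (everHitProb κ A) :=
  Measurable.iSup fun n => measurable_hitProb hA n

lemma hitProb_of_mem (hx : x ∈ A) (n : ℕ) : hitProb κ A n x = 1 := by
  cases n <;> simp [hitProb, hx]

lemma hitProb_zero_of_notMem (hx : x ∉ A) : hitProb κ A 0 x = 0 := by
  simp [hitProb, hx]

lemma hitProb_succ_of_notMem (hx : x ∉ A) (n : ℕ) :
    hitProb κ A (n + 1) x = ∫⁻ y, hitProb κ A n y ∂κ x := by
  simp [hitProb, hx]

lemma everHitProb_of_mem (hx : x ∈ A) : everHitProb κ A x = 1 := by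
  simp only [everHitProb, hitProb_of_mem hx, ciSup_const]

lemma hitProb_mono (κ : Kernel S S) (A : Set S) : Monotone (hitProb κ A) := by
  refine monotone_nat_of_le_succ fun n => ?_
  induction n with
  | zero =>
    intro x
    by_cases hx : x ∈ A
    · rw [hitProb_of_mem hx, hitProb_of_mem hx]
    · simp [hitProb_zero_of_notMem hx]
  | succ n ih =>
    intro x
    by_cases hx : x ∈ A
    · rw [hitProb_of_mem hx, hitProb_of_mem hx]
    · rw [hitProb_succ_of_notMem hx, hitProb_succ_of_notMem hx]
      exact lintegral_mono ih

lemma lintegral_everHitProb (hA : MeasurableSet A) (x : S) :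
    ∫⁻ y, everHitProb κ A y ∂κ x = ⨆ n, ∫⁻ y, hitProb κ A n y ∂κ x :=
  lintegral_iSup (fun n => measurable_hitProb hA n) (hitProb_mono κ A)

lemma everHitProb_of_notMem (hA : MeasurableSet A) (hx : x ∉ A) :
    everHitProb κ A x = ∫⁻ y, everHitProb κ A y ∂κ x := by
  rw [lintegral_everHitProb hA]
  refine le_antisymm (iSup_le fun n => ?_) (iSup_le fun n => ?_)
  · cases n with
    | zero => simp [hitProb_zero_of_notMem hx]
    | succ n =>
      rw [hitProb_succ_of_notMem hx]
      exact le_iSup_of_le n le_rfl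
  · rw [← hitProb_succ_of_notMem hx]
    exact le_iSup_of_le (n + 1) le_rfl

lemma hitProb_le_one [IsMarkovKernel κ] (n : ℕ) (x : S) : hitProb κ A n x ≤ 1 := by
  by_cases hx : x ∈ A
  · rw [hitProb_of_mem hx]
  induction n generalizing x with
  | zero => simp [hitProb_zero_of_notMem hx]
  | succ n ih =>
    rw [hitProb_succ_of_notMem hx]
    refine lintegral_le_const (Eventually.of_forall fun y => ?_)
    by_cases hy : y ∈ A
    · rw [hitProb_of_mem hy]
    · exact ih y hy

lemma everHitProb_le_one [IsMarkovKernel κ] (x : S) : everHitProb κ A x ≤ 1 :=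
  iSup_le fun n => hitProb_le_one n x

lemma lintegral_everHitProb_le [IsMarkovKernel κ] (hA : MeasurableSet A) (x : S) :
    ∫⁻ y, everHitProb κ A y ∂κ x ≤ everHitProb κ A x := by
  by_cases hx : x ∈ A
  · rw [everHitProb_of_mem hx]
    exact lintegral_le_const (Eventually.of_forall everHitProb_le_one)
  · exact (everHitProb_of_notMem hA hx).ge

end MarkovChain

section UniformEscape

variable {S : Type*} [MeasurableSpace S]

/-- Uniform escape: along the chain with transition kernel `κ`, which stays in `G`, the level `ℓ`
decreases by at most one per step; a one-level descent never occurs with probability at least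
`q`, and with probability at least `ε` the chain stays above its present level from the next step
on. -/
structure EscapesUniformly (κ : Kernel S S) (G : Set S) (ℓ : S → ℕ) (q ε : ℝ) : Prop where
  measurable_level : Measurable ℓ
  q_pos : 0 < q
  q_le_one : q ≤ 1
  ε_pos : 0 < ε
  ε_le_one : ε ≤ 1
  ae_mem_and_level_le : ∀ x ∈ G, ∀ᵐ y ∂κ x, y ∈ G ∧ ℓ x ≤ ℓ y + 1
  hitProb_le : ∀ x ∈ G, ∀ j n, ℓ x = j + 1 →
    hitProb κ {y | ℓ y ≤ j} n x ≤ ENNReal.ofReal (1 - q)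
  lintegral_hitProb_le : ∀ x ∈ G, ∀ n,
    ∫⁻ y, hitProb κ {y | ℓ y ≤ ℓ x} n y ∂κ x ≤ ENNReal.ofReal (1 - ε)

/-- The Lyapunov function `x ↦ ∑ j, a ^ j * P_x(the level j or a lower one is reached)`. -/
def levelPotential (κ : Kernel S S) (ℓ : S → ℕ) (a : ℝ≥0∞) (x : S) : ℝ≥0∞ :=
  ∑' j, a ^ j * everHitProb κ {y | ℓ y ≤ j} x

/-- The lower bound on the speed of a chain that escapes uniformly with parameters `q` and `ε`. -/
def escapeSpeed (q ε : ℝ) : ℝ :=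
  Real.log (1 - ε * q / 4) / (2 * Real.log (1 - q / 2))

variable {κ : Kernel S S} {G : Set S} {ℓ : S → ℕ} {q ε : ℝ} {x : S}

lemma measurable_levelPotential (hℓ : Measurable ℓ) (a : ℝ≥0∞) :
    Measurable (levelPotential κ ℓ a) :=
  Measurable.tsum fun _ => (measurable_everHitProb (hℓ measurableSet_Iic)).const_mul _

lemma pow_level_le_levelPotential (a : ℝ≥0∞) (x : S) : a ^ ℓ x ≤ levelPotential κ ℓ a x := by
  calc a ^ ℓ x = a ^ ℓ x * everHitProb κ {y | ℓ y ≤ ℓ x} x := by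
        rw [everHitProb_of_mem (A := {y | ℓ y ≤ ℓ x}) (le_refl (ℓ x)), mul_one]
    _ ≤ levelPotential κ ℓ a x := ENNReal.le_tsum _

lemma tsum_pow_absdiff_le (a : ℝ≥0∞) (l : ℕ) :
    ∑' j : ℕ, a ^ ((l - j) + (j - l)) ≤ 2 * (1 - a)⁻¹ := by
  rw [← Summable.sum_add_tsum_nat_add' (k := l) ENNReal.summable, two_mul,
    ← ENNReal.tsum_geometric]
  gcongr ?_ + ?_
  · rw [← Finset.sum_range_reflect]
    calc ∑ i ∈ Finset.range l, a ^ ((l - (l - 1 - i)) + (l - 1 - i - l))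
        = ∑ i ∈ Finset.range l, a ^ (i + 1) := by
          refine Finset.sum_congr rfl fun i hi => ?_
          rw [Finset.mem_range] at hi
          rw [show l - (l - 1 - i) + (l - 1 - i - l) = i + 1 by omega]
      _ = ∑ i ∈ (Finset.range l).map ⟨(· + 1), add_left_injective 1⟩, a ^ i := by
          rw [Finset.sum_map]
          rfl
      _ ≤ ∑' i, a ^ i := ENNReal.sum_le_tsum _
  · exact ENNReal.tsum_le_tsum fun i => by rw [show l - (i + l) + (i + l - l) = i by omega]

namespace EscapesUniformly

lemma measurableSet_level_le (h : EscapesUniformly κ G ℓ q ε) (j : ℕ) :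
    MeasurableSet {x | ℓ x ≤ j} :=
  h.measurable_level measurableSet_Iic

lemma hitProb_le_mul (h : EscapesUniformly κ G ℓ q ε) {β : ℝ≥0∞} {j l : ℕ} (hjl : j ≤ l)
    (hβ : ∀ x ∈ G, ℓ x = l → ∀ n, hitProb κ {y | ℓ y ≤ j} n x ≤ β) (n : ℕ) (hx : x ∈ G)
    (hl : l ≤ ℓ x) :
    hitProb κ {y | ℓ y ≤ j} n x ≤ β * hitProb κ {y | ℓ y ≤ l} n x := by
  rcases hl.eq_or_lt with hl | hl
  · rw [hitProb_of_mem (A := {y | ℓ y ≤ l}) hl.ge, mul_one]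
    exact hβ x hx hl.symm n
  have hxj : x ∉ {y | ℓ y ≤ j} := (hjl.trans_lt hl).not_ge
  have hxl : x ∉ {y | ℓ y ≤ l} := hl.not_ge
  induction n generalizing x with
  | zero => simp [hitProb_zero_of_notMem hxj]
  | succ n ih =>
    rw [hitProb_succ_of_notMem hxj, hitProb_succ_of_notMem hxl,
      ← lintegral_const_mul _ (measurable_hitProb (h.measurableSet_level_le l) n)]
    refine lintegral_mono_ae ((h.ae_mem_and_level_le x hx).mono fun y ⟨hy, _⟩ => ?_)
    rcases (show l ≤ ℓ y by omega).eq_or_lt with hly | hly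
    · rw [hitProb_of_mem (A := {y | ℓ y ≤ l}) hly.ge, mul_one]
      exact hβ y hy hly.symm n
    · exact ih hy hly.le hly (hjl.trans_lt hly).not_ge hly.not_ge

lemma hitProb_le_pow [IsMarkovKernel κ] (h : EscapesUniformly κ G ℓ q ε) (hx : x ∈ G) (j n : ℕ) :
    hitProb κ {y | ℓ y ≤ j} n x ≤ ENNReal.ofReal (1 - q) ^ (ℓ x - j) := by
  obtain ⟨k, hk⟩ : ∃ k, ℓ x - j = k := ⟨_, rfl⟩
  rw [hk]
  induction k generalizing x n with
  | zero => simpa using hitProb_le_one n x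
  | succ k ih =>
    calc hitProb κ {y | ℓ y ≤ j} n x
        ≤ ENNReal.ofReal (1 - q) ^ k * hitProb κ {y | ℓ y ≤ j + k} n x :=
          h.hitProb_le_mul (by omega) (fun y hy hly n => ih hy n (by omega)) n hx (by omega)
      _ ≤ ENNReal.ofReal (1 - q) ^ (k + 1) := by
          rw [pow_succ]
          gcongr
          exact h.hitProb_le x hx (j + k) n (by omega)

lemma levelPotential_le [IsMarkovKernel κ] (h : EscapesUniformly κ G ℓ q ε) {a : ℝ≥0∞}
    (ha : ENNReal.ofReal (1 - q) ≤ a ^ 2) (hx : x ∈ G) :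
    levelPotential κ ℓ a x ≤ 2 * (1 - a)⁻¹ * a ^ ℓ x := by
  calc levelPotential κ ℓ a x
      ≤ ∑' j, a ^ ((ℓ x - j) + (j - ℓ x)) * a ^ ℓ x := by
        refine ENNReal.tsum_le_tsum fun j => ?_
        calc a ^ j * everHitProb κ {y | ℓ y ≤ j} x ≤ a ^ j * (a ^ 2) ^ (ℓ x - j) := by
              gcongr
              exact iSup_le fun n => (h.hitProb_le_pow hx j n).trans (by gcongr)
          _ = a ^ ((ℓ x - j) + (j - ℓ x)) * a ^ ℓ x := by
              rw [← pow_mul, ← pow_add, ← pow_add]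
              congr 1
              omega
    _ ≤ 2 * (1 - a)⁻¹ * a ^ ℓ x := by
        rw [ENNReal.tsum_mul_right]
        gcongr
        exact tsum_pow_absdiff_le a _

lemma lintegral_levelPotential_add_le [IsMarkovKernel κ] (h : EscapesUniformly κ G ℓ q ε)
    (a : ℝ≥0∞) (hx : x ∈ G) :
    ∫⁻ y, levelPotential κ ℓ a y ∂κ x + ENNReal.ofReal ε * a ^ ℓ x ≤ levelPotential κ ℓ a x := by
  have hmeas := fun j => measurable_everHitProb (κ := κ) (h.measurableSet_level_le j)
  have hintegral : ∫⁻ y, levelPotential κ ℓ a y ∂κ x =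
      ∑' j, a ^ j * ∫⁻ y, everHitProb κ {z | ℓ z ≤ j} y ∂κ x := by
    simp only [levelPotential]
    rw [lintegral_tsum fun j => ((hmeas j).const_mul _).aemeasurable]
    exact tsum_congr fun j => lintegral_const_mul _ (hmeas j)
  have hgain : ENNReal.ofReal ε * a ^ ℓ x =
      ∑' j, if j = ℓ x then a ^ j * ENNReal.ofReal ε else 0 := by
    rw [tsum_ite_eq, mul_comm]
  rw [hintegral, hgain, ← ENNReal.tsum_add]
  refine ENNReal.tsum_le_tsum fun j => ?_
  split_ifs with hj
  · subst hj
    have hreturn : ∫⁻ y, everHitProb κ {z | ℓ z ≤ ℓ x} y ∂κ x ≤ ENNReal.ofReal (1 - ε) := by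
      rw [lintegral_everHitProb (h.measurableSet_level_le _)]
      exact iSup_le (h.lintegral_hitProb_le x hx)
    rw [← mul_add, everHitProb_of_mem (A := {y | ℓ y ≤ ℓ x}) (le_refl (ℓ x))]
    gcongr
    calc _ ≤ ENNReal.ofReal (1 - ε) + ENNReal.ofReal ε := by gcongr
      _ = 1 := by rw [← ENNReal.ofReal_add (by linarith [h.ε_le_one]) h.ε_pos.le]; simp
  · rw [add_zero]
    gcongr
    exact lintegral_everHitProb_le (h.measurableSet_level_le j) x

lemma levelPotential_le_ofReal [IsMarkovKernel κ] (h : EscapesUniformly κ G ℓ q ε) (hx : x ∈ G) :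
    levelPotential κ ℓ (ENNReal.ofReal (1 - q / 2)) x ≤
      ENNReal.ofReal (4 / q) * ENNReal.ofReal (1 - q / 2) ^ ℓ x := by
  have hq0 := h.q_pos
  have hq1 := h.q_le_one
  have hconst : 2 * (1 - ENNReal.ofReal (1 - q / 2))⁻¹ = ENNReal.ofReal (4 / q) := by
    rw [← ENNReal.ofReal_one, ← ENNReal.ofReal_sub _ (by linarith), sub_sub_cancel,
      ← ENNReal.ofReal_inv_of_pos (by linarith), ← ENNReal.ofReal_ofNat,
      ← ENNReal.ofReal_mul (by norm_num)]
    congr 1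
    field_simp
    norm_num
  rw [← hconst]
  refine h.levelPotential_le ?_ hx
  rw [← ENNReal.ofReal_pow (by linarith)]
  exact ENNReal.ofReal_le_ofReal (by nlinarith)

lemma lintegral_levelPotential_le [IsMarkovKernel κ] (h : EscapesUniformly κ G ℓ q ε)
    (hx : x ∈ G) :
    ∫⁻ y, levelPotential κ ℓ (ENNReal.ofReal (1 - q / 2)) y ∂κ x ≤
      ENNReal.ofReal (1 - ε * q / 4) * levelPotential κ ℓ (ENNReal.ofReal (1 - q / 2)) x := by
  have hq0 := h.q_pos
  have hε0 := h.ε_pos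
  set a := ENNReal.ofReal (1 - q / 2)
  set Y := levelPotential κ ℓ a x
  have hY : Y ≠ ⊤ := ((h.levelPotential_le_ofReal hx).trans_lt
    (ENNReal.mul_lt_top ENNReal.ofReal_lt_top (ENNReal.pow_lt_top ENNReal.ofReal_lt_top))).ne
  have hloss : ENNReal.ofReal (ε * q / 4) * Y ≤ ENNReal.ofReal ε * a ^ ℓ x := by
    calc _ ≤ ENNReal.ofReal (ε * q / 4) * (ENNReal.ofReal (4 / q) * a ^ ℓ x) := by
          gcongr
          exact h.levelPotential_le_ofReal hx
      _ = ENNReal.ofReal ε * a ^ ℓ x := by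
          rw [← mul_assoc, ← ENNReal.ofReal_mul (by positivity)]
          congr 2
          field_simp
  rw [ENNReal.ofReal_sub _ (by positivity), ENNReal.ofReal_one, ENNReal.sub_mul (fun _ _ => hY),
    one_mul]
  refine ENNReal.le_sub_of_add_le_right (ENNReal.mul_ne_top ENNReal.ofReal_ne_top hY) ?_
  exact le_trans (by gcongr) (h.lintegral_levelPotential_add_le a hx)

lemma lintegral_pow_level_markovLaw_le [IsMarkovKernel κ] (h : EscapesUniformly κ G ℓ q ε)
    (hx : x ∈ G) (n : ℕ) :
    ∫⁻ ω, ENNReal.ofReal (1 - q / 2) ^ ℓ (ω n) ∂markovLaw κ x ≤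
      ENNReal.ofReal (1 - ε * q / 4) ^ n * ENNReal.ofReal (4 / q) := by
  have hq0 := h.q_pos
  set a := ENNReal.ofReal (1 - q / 2)
  have ha : a ≤ 1 := ENNReal.ofReal_le_one.2 (by linarith)
  have hpot := measurable_levelPotential (κ := κ) h.measurable_level a
  calc ∫⁻ ω, a ^ ℓ (ω n) ∂markovLaw κ x
      ≤ ∫⁻ ω, levelPotential κ ℓ a (ω n) ∂markovLaw κ x :=
        lintegral_mono fun ω => pow_level_le_levelPotential a (ω n)
    _ = ∫⁻ y, levelPotential κ ℓ a y ∂(κ ^ n) x := by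
        rw [← map_eval_markovLaw, lintegral_map hpot (measurable_pi_apply n)]
    _ ≤ ENNReal.ofReal (1 - ε * q / 4) ^ n * levelPotential κ ℓ a x :=
        lintegral_pow_le_of_drift hpot
          (fun x hx => (h.ae_mem_and_level_le x hx).mono fun _ => And.left)
          (fun x hx => h.lintegral_levelPotential_le hx) n hx
    _ ≤ ENNReal.ofReal (1 - ε * q / 4) ^ n * ENNReal.ofReal (4 / q) := by
        gcongr
        exact (h.levelPotential_le_ofReal hx).trans (mul_le_of_le_one_right' (pow_le_one' ha _))

end EscapesUniformly

lemma measure_le_mul_le_of_lintegral_pow_le {Ω : Type*} [MeasurableSpace Ω] {μ : Measure Ω}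
    {Z : Ω → ℕ} (hZ : Measurable Z) {a b c : ℝ} {K : ℝ≥0∞} (ha0 : 0 < a) (ha1 : a ≤ 1)
    (hb : 0 < b) (hac : a ^ c = b) (n : ℕ)
    (h : ∫⁻ ω, ENNReal.ofReal a ^ Z ω ∂μ ≤ ENNReal.ofReal (b * b) ^ n * K) :
    μ {ω | (Z ω : ℝ) ≤ c * n} ≤ ENNReal.ofReal b ^ n * K := by
  have hbn : ENNReal.ofReal b ^ n ≠ 0 := pow_ne_zero _ (ENNReal.ofReal_pos.2 hb).ne'
  have hbn' : ENNReal.ofReal b ^ n ≠ ⊤ := ENNReal.pow_ne_top ENNReal.ofReal_ne_top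
  have hsub : {ω | (Z ω : ℝ) ≤ c * n} ⊆
      {ω | ENNReal.ofReal b ^ n ≤ ENNReal.ofReal a ^ Z ω} := by
    intro ω hω
    rw [Set.mem_ofPred_eq, ← ENNReal.ofReal_pow hb.le, ← ENNReal.ofReal_pow ha0.le, ← hac,
      ← Real.rpow_natCast, ← Real.rpow_mul ha0.le, ← Real.rpow_natCast a]
    exact ENNReal.ofReal_le_ofReal (Real.rpow_le_rpow_of_exponent_ge ha0 ha1 hω)
  calc μ {ω | (Z ω : ℝ) ≤ c * n}
      ≤ (∫⁻ ω, ENNReal.ofReal a ^ Z ω ∂μ) / ENNReal.ofReal b ^ n :=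
        (measure_mono hsub).trans (meas_ge_le_lintegral_div
          ((measurable_from_nat (f := (ENNReal.ofReal a ^ ·))).comp hZ).aemeasurable hbn hbn')
    _ ≤ ENNReal.ofReal b ^ n * K := by
        rw [ENNReal.div_le_iff hbn hbn']
        refine h.trans_eq ?_
        rw [ENNReal.ofReal_mul hb.le, mul_pow, mul_right_comm]

lemma ae_le_liminf_div_of_lintegral_pow_le {Ω : Type*} [MeasurableSpace Ω] {μ : Measure Ω}
    {Z : ℕ → Ω → ℕ} (hZ : ∀ n, Measurable (Z n)) {a r : ℝ} {K : ℝ≥0∞} (hK : K ≠ ⊤) (ha0 : 0 < a)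
    (ha1 : a < 1) (hr0 : 0 < r) (hr1 : r < 1)
    (h : ∀ n, ∫⁻ ω, ENNReal.ofReal a ^ Z n ω ∂μ ≤ ENNReal.ofReal r ^ n * K) :
    ∀ᵐ ω ∂μ, ((Real.log r / (2 * Real.log a) : ℝ) : EReal) ≤
      liminf (fun n : ℕ => (((Z n ω : ℝ) / (n : ℝ) : ℝ) : EReal)) atTop := by
  set c : ℝ := Real.log r / (2 * Real.log a) with hc
  have hac : a ^ c = √r := by
    rw [Real.sqrt_eq_rpow, Real.rpow_def_of_pos ha0, Real.rpow_def_of_pos hr0, hc]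
    congr 1
    field_simp [(Real.log_neg ha0 ha1).ne]
  have hmarkov : ∀ n, μ {ω | (Z n ω : ℝ) ≤ c * n} ≤ ENNReal.ofReal √r ^ n * K := fun n =>
    measure_le_mul_le_of_lintegral_pow_le (hZ n) ha0 ha1.le (Real.sqrt_pos.2 hr0) hac n
      (by rw [Real.mul_self_sqrt hr0.le]; exact h n)
  have hsum : ∑' n : ℕ, μ {ω | (Z n ω : ℝ) ≤ c * n} ≠ ⊤ := by
    refine ne_top_of_le_ne_top ?_ (ENNReal.tsum_le_tsum hmarkov)
    rw [ENNReal.tsum_mul_right, ENNReal.tsum_geometric]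
    refine ENNReal.mul_ne_top (ENNReal.inv_ne_top.2 (tsub_pos_of_lt ?_).ne') hK
    exact ENNReal.ofReal_lt_one.2 ((Real.sqrt_lt' one_pos).2 (by simpa using hr1))
  filter_upwards [ae_eventually_notMem hsum] with ω hω
  refine le_liminf_of_le (by isBoundedDefault) ?_
  filter_upwards [hω, eventually_gt_atTop 0] with n hn hn0
  rw [EReal.coe_le_coe_iff, le_div_iff₀ (Nat.cast_pos.2 hn0)]
  exact (not_le.1 hn).le

namespace EscapesUniformly

lemma escapeSpeed_pos (h : EscapesUniformly κ G ℓ q ε) : 0 < escapeSpeed q ε := by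
  have hq0 := h.q_pos
  have hq1 := h.q_le_one
  have hε0 := h.ε_pos
  have hε1 := h.ε_le_one
  have hεq : 0 < ε * q := mul_pos hε0 hq0
  exact div_pos_of_neg_of_neg (Real.log_neg (by nlinarith) (by linarith))
    (by linarith [Real.log_neg (show 0 < 1 - q / 2 by linarith) (by linarith)])

lemma ae_escapeSpeed_le_liminf [IsMarkovKernel κ] (h : EscapesUniformly κ G ℓ q ε) (hx : x ∈ G) :
    ∀ᵐ ω ∂markovLaw κ x, (escapeSpeed q ε : EReal) ≤
      liminf (fun n : ℕ => (((ℓ (ω n) : ℝ) / (n : ℝ) : ℝ) : EReal)) atTop := by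
  have hq0 := h.q_pos
  have hq1 := h.q_le_one
  have hε1 := h.ε_le_one
  have hεq : 0 < ε * q := mul_pos h.ε_pos hq0
  have ha0 : 0 < 1 - q / 2 := by linarith
  have ha1 : 1 - q / 2 < 1 := by linarith
  have hr0 : 0 < 1 - ε * q / 4 := by nlinarith
  have hr1 : 1 - ε * q / 4 < 1 := by linarith
  have hℓ : ∀ n, Measurable fun ω : ℕ → S => ℓ (ω n) := fun n =>
    h.measurable_level.comp (measurable_pi_apply n)
  exact ae_le_liminf_div_of_lintegral_pow_le hℓ ENNReal.ofReal_ne_top ha0 ha1 hr0 hr1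
    (h.lintegral_pow_level_markovLaw_le hx)

end EscapesUniformly

end UniformEscape

section Graph

variable {V : Type*} {G H : SimpleGraph V} {r u v w : V}

lemma notMem_support_of_length_lt_dist (p : G.Walk r u) (h : p.length < G.dist r v) :
    v ∉ p.support := by
  classical
  intro hv
  have hdist := dist_le (p.takeUntil v hv)
  have hlength := p.length_takeUntil_le_length hv
  omega

lemma eq_of_adj_of_dist_eq_dist_add_one (hG : G.IsAcyclic) (hu : G.Adj v u) (hw : G.Adj v w)
    (hr : G.Reachable r v) (hdu : G.dist r v = G.dist r u + 1)
    (hdw : G.dist r v = G.dist r w + 1) : u = w := by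
  obtain ⟨p, hp, hpl⟩ := (hr.trans hu.reachable).exists_path_of_dist
  obtain ⟨q, hq, hql⟩ := (hr.trans hw.reachable).exists_path_of_dist
  have hvp := notMem_support_of_length_lt_dist (v := v) p (by omega)
  have hvq := notMem_support_of_length_lt_dist (v := v) q (by omega)
  have hpath := (hG.subsingleton_path r v).elim ⟨_, hp.concat hvp hu.symm⟩
    ⟨_, hq.concat hvq hw.symm⟩
  simpa using congrArg (fun x : G.Path r v => x.1.penultimate) hpath

lemma exists_adj_dist_eq_dist_add_one (hr : G.Reachable r v) (hne : r ≠ v) :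
    ∃ u, G.Adj v u ∧ G.dist r v = G.dist r u + 1 := by
  obtain ⟨p, hp⟩ := hr.symm.exists_walk_length_eq_dist
  cases p with
  | nil => exact absurd rfl hne
  | @cons _ u _ h q =>
    have hadj := h.symm.diff_dist_adj (u := r)
    have hle := dist_le q
    rw [Walk.length_cons, dist_comm] at hp
    rw [dist_comm] at hle
    exact ⟨u, h, by omega⟩

lemma dist_eq_of_le_of_isAcyclic (hle : G ≤ H) (hH : H.IsAcyclic) (hr : G.Reachable u v) :
    H.dist u v = G.dist u v := by
  obtain ⟨p, hp, hpl⟩ := hr.exists_path_of_dist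
  obtain ⟨q, hq, hql⟩ := (hr.mono hle).exists_path_of_dist
  have hpath := (hH.subsingleton_path u v).elim ⟨_, hp.mapLe hle⟩ ⟨q, hq⟩
  have hlength := congrArg (fun x : H.Path u v => x.1.length) hpath
  simp only [Walk.length_map, Walk.mapLe] at hlength
  omega

lemma exists_walk_length_succ_iff {n : ℕ} :
    (∃ p : G.Walk u v, p.length = n + 1) ↔
      ∃ w, G.Adj u w ∧ ∃ p : G.Walk w v, p.length = n := by
  constructor
  · rintro ⟨p, hp⟩
    cases p with
    | nil => simp at hp
    | cons h q => exact ⟨_, h, q, by simpa using hp⟩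
  · rintro ⟨w, h, q, hq⟩
    exact ⟨Walk.cons h q, by rw [Walk.length_cons, hq]⟩

end Graph

namespace State

variable {s : State} {root a a' c u v w x y : ℕ}

lemma isAcyclic (s : State) : s.tree.spanningCoe.IsAcyclic :=
  isAcyclic_spanningCoe _ s.isTree.2

lemma reachable (s : State) (hu : u ∈ s.tree.verts) (hv : v ∈ s.tree.verts) :
    s.tree.spanningCoe.Reachable u v :=
  (s.isTree.1.preconnected ⟨u, hu⟩ ⟨v, hv⟩).map
    (⟨Subtype.val, fun h => h⟩ : s.tree.coe →g s.tree.spanningCoe)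

/-- `c` is a child of `a` in the tree of `s` rooted at `root`. -/
def IsChild (s : State) (root a c : ℕ) : Prop :=
  s.tree.Adj a c ∧ s.dist c root = s.dist a root + 1

/-- `x` is a descendant of `v` (possibly `v` itself) in the tree of `s` rooted at `root`. -/
def IsDescendant (s : State) (root : ℕ) : ℕ → ℕ → Prop := Relation.ReflTransGen (s.IsChild root)

/-- The level of the walker: its distance to the root. -/
def level (root : ℕ) (s : State) : ℕ := s.dist s.walker root

lemma isChild_or_isChild_of_adj (hroot : root ∈ s.tree.verts) (h : s.tree.Adj u v) :
    s.IsChild root u v ∨ s.IsChild root v u := by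
  have hdist := s.isAcyclic.dist_eq_dist_add_one_of_adj_of_reachable root
    (show s.tree.spanningCoe.Adj u v from h) (s.reachable hroot (s.tree.edge_vert h))
  simp only [dist_comm (u := root)] at hdist
  exact hdist.symm.imp (⟨h, ·⟩) (⟨h.symm, ·⟩)

lemma IsChild.parent_unique (hroot : root ∈ s.tree.verts) (h : s.IsChild root a c)
    (h' : s.IsChild root a' c) : a = a' := by
  have hdist := h.2
  have hdist' := h'.2
  simp only [State.dist, dist_comm (v := root)] at hdist hdist'
  exact eq_of_adj_of_dist_eq_dist_add_one s.isAcyclic h.1.symm h'.1.symm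
    (s.reachable hroot (s.tree.edge_vert h.1.symm)) hdist hdist'

lemma exists_isChild (hroot : root ∈ s.tree.verts) (hv : v ∈ s.tree.verts)
    (hne : s.dist v root ≠ 0) : ∃ u, s.IsChild root u v := by
  have hrv : root ≠ v := by
    rintro rfl
    exact hne SimpleGraph.dist_self
  obtain ⟨u, hadj, hdist⟩ := exists_adj_dist_eq_dist_add_one (s.reachable hroot hv) hrv
  simp only [dist_comm (u := root)] at hdist
  exact ⟨u, Subgraph.Adj.symm hadj, hdist⟩

lemma IsDescendant.dist_le (h : s.IsDescendant root v x) : s.dist v root ≤ s.dist x root := by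
  induction h with
  | refl => exact le_rfl
  | tail _ h ih => exact ih.trans (h.2 ▸ Nat.le_succ _)

lemma IsDescendant.parent (hroot : root ∈ s.tree.verts) (h : s.IsDescendant root v x)
    (hne : x ≠ v) (hy : s.IsChild root y x) : s.IsDescendant root v y := by
  rcases Relation.ReflTransGen.cases_tail h with h | ⟨w, hw, hwx⟩
  · exact absurd h hne
  · rwa [hy.parent_unique hroot hwx]

@[simp] lemma walker_grow (s : State) : s.grow.walker = s.walker := rfl

lemma mem_verts_grow : v ∈ s.grow.tree.verts ↔ v ∈ s.tree.verts ∨ v = s.newVertex :=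
  s.mem_verts_grownTree v

lemma mem_verts_grow_of_mem (hv : v ∈ s.tree.verts) : v ∈ s.grow.tree.verts :=
  mem_verts_grow.2 (Or.inl hv)

lemma adj_grow : s.grow.tree.Adj u v ↔ s.tree.Adj u v ∨
    (u = s.walker ∧ v = s.newVertex) ∨ (u = s.newVertex ∧ v = s.walker) :=
  s.adj_grownTree u v

lemma dist_grow (hu : u ∈ s.tree.verts) (hv : v ∈ s.tree.verts) :
    s.grow.dist u v = s.dist u v :=
  dist_eq_of_le_of_isAcyclic (fun _ _ h => adj_grow.2 (Or.inl h)) s.grow.isAcyclic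
    (s.reachable hu hv)

lemma level_grow (hroot : root ∈ s.tree.verts) : level root s.grow = level root s :=
  dist_grow s.walker_mem hroot

lemma IsChild.grow (hroot : root ∈ s.tree.verts) (h : s.IsChild root a c) :
    s.grow.IsChild root a c := by
  refine ⟨adj_grow.2 (Or.inl h.1), ?_⟩
  rw [dist_grow (s.tree.edge_vert h.1) hroot, dist_grow (s.tree.edge_vert h.1.symm) hroot, h.2]

lemma IsDescendant.grow (hroot : root ∈ s.tree.verts) (h : s.IsDescendant root v x) :
    s.grow.IsDescendant root v x :=
  h.lift id fun _ _ h => h.grow hroot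

lemma isChild_newVertex (hroot : root ∈ s.tree.verts) :
    s.grow.IsChild root s.walker s.newVertex := by
  have hroot' := mem_verts_grow_of_mem hroot
  have hadj : s.grow.tree.Adj s.walker s.newVertex := adj_grow.2 (Or.inr (Or.inl ⟨rfl, rfl⟩))
  refine (isChild_or_isChild_of_adj hroot' hadj).resolve_right fun h => ?_
  have hne : s.grow.dist s.newVertex root ≠ 0 := by
    intro h0
    have heq := (s.grow.reachable (mem_verts_grow.2 (Or.inr rfl)) hroot').dist_eq_zero_iff.1 h0
    exact s.newVertex_notMem (heq ▸ hroot)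
  obtain ⟨u, hu⟩ := exists_isChild hroot' (mem_verts_grow.2 (Or.inr rfl)) hne
  have hu' : u = s.walker := by
    rcases adj_grow.1 hu.1.symm with h1 | h1 | h1
    · exact absurd (s.tree.edge_vert h1) s.newVertex_notMem
    · exact absurd (h1.1 ▸ s.walker_mem) s.newVertex_notMem
    · exact h1.2
  have hdist := hu.2
  have hdist' := h.2
  rw [hu'] at hdist
  omega

@[simp] lemma dist_moveTo (s : State) (y u v : ℕ) : (s.moveTo y).dist u v = s.dist u v := by
  simp only [State.dist, tree_moveTo]

@[simp] lemma isChild_moveTo (s : State) (y root : ℕ) :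
    (s.moveTo y).IsChild root = s.IsChild root := by
  ext
  simp [IsChild, tree_moveTo]

@[simp] lemma isDescendant_moveTo (s : State) (y root : ℕ) :
    (s.moveTo y).IsDescendant root = s.IsDescendant root := by
  simp only [IsDescendant, isChild_moveTo]

lemma mem_verts_of_mem_targets (hy : y ∈ s.targets) : y ∈ s.tree.verts := by
  unfold targets at hy
  split_ifs at hy
  · exact s.tree.edge_vert (Subgraph.Adj.symm hy)
  · exact hy ▸ s.walker_mem

lemma walker_moveTo_of_mem_targets (hy : y ∈ s.targets) : (s.moveTo y).walker = y := by
  rw [walker_moveTo, if_pos (mem_verts_of_mem_targets hy)]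

lemma mem_targets_of_adj (h : s.tree.Adj s.walker y) : y ∈ s.targets := by
  unfold targets
  rwa [if_pos ⟨y, h⟩]

lemma mem_targets_iff_of_adj (hx : s.tree.Adj s.walker x) :
    y ∈ s.targets ↔ s.tree.Adj s.walker y := by
  unfold targets
  rw [if_pos ⟨x, hx⟩]
  rfl

lemma targets_cases (s : State) : (∀ y ∈ s.targets, s.tree.Adj s.walker y) ∨
    s.targets = {s.walker} := by
  unfold targets
  split_ifs
  · exact Or.inl fun y hy => hy
  · exact Or.inr rfl

lemma level_le_level_moveTo_add_one (hroot : root ∈ s.tree.verts) (hy : y ∈ s.targets) :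
    level root s ≤ level root (s.moveTo y) + 1 := by
  unfold level
  rw [walker_moveTo_of_mem_targets hy, dist_moveTo]
  rcases s.targets_cases with h | h
  · rcases isChild_or_isChild_of_adj hroot (h y hy) with h' | h' <;>
      (have hdist := h'.2; omega)
  · rw [h, Set.mem_singleton_iff] at hy
    rw [hy]
    exact Nat.le_succ _

lemma measurable_exists_walk_length_eq (n u v : ℕ) :
    Measurable fun s : State => ∃ p : s.tree.spanningCoe.Walk u v, p.length = n := by
  induction n generalizing u with
  | zero => simp only [Walk.exists_length_eq_zero_iff, measurable_const]
  | succ n ih =>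
    simp only [exists_walk_length_succ_iff]
    exact Measurable.exists fun w => (measurable_adj u w).and (ih w)

lemma dist_le_iff_exists_walk {k : ℕ} : s.dist u v ≤ k ↔
    (∃ n, n ≤ k ∧ ∃ p : s.tree.spanningCoe.Walk u v, p.length = n) ∨
      ∀ n, ¬ ∃ p : s.tree.spanningCoe.Walk u v, p.length = n := by
  constructor
  · intro h
    by_cases hr : s.tree.spanningCoe.Reachable u v
    · exact Or.inl ⟨_, h, hr.exists_walk_length_eq_dist⟩
    · exact Or.inr fun n ⟨p, _⟩ => hr ⟨p⟩
  · rintro (⟨n, hn, p, rfl⟩ | h)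
    · exact (SimpleGraph.dist_le p).trans hn
    · exact (dist_eq_zero_of_not_reachable fun ⟨p⟩ => h _ ⟨p, rfl⟩).trans_le k.zero_le

lemma measurable_dist (u v : ℕ) : Measurable fun s : State => s.dist u v := by
  refine measurable_of_Iic fun k => ?_
  simp only [Set.preimage, Set.mem_Iic, dist_le_iff_exists_walk]
  refine measurableSet_setOfPred.2 (Measurable.or ?_ ?_)
  · exact Measurable.exists fun n =>
      measurable_const.and (measurable_exists_walk_length_eq n u v)
  · exact Measurable.forall fun n => (measurable_exists_walk_length_eq n u v).not

lemma measurable_level (root : ℕ) : Measurable (level root) :=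
  (measurable_from_prod_countable_right (f := fun z : ℕ × State => z.2.dist z.1 root)
    fun x => measurable_dist x root).comp (measurable_walker.prodMk measurable_id)

/-- The possible positions after one step of the walker, as a finite set. -/
def targetsFinset (s : State) : Finset ℕ := s.targets_finite.toFinset

@[simp] lemma mem_targetsFinset : y ∈ s.targetsFinset ↔ y ∈ s.targets := by
  simp [targetsFinset]

lemma card_targetsFinset_pos (s : State) : 0 < s.targetsFinset.card :=
  Finset.card_pos.2 (s.targets_finite.toFinset_nonempty.2 s.targets_nonempty)

open Classical in
lemma card_filter_not_isChild_targets_le_one (hroot : root ∈ s.tree.verts) :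
    (s.targetsFinset.filter fun y => ¬ s.IsChild root s.walker y).card ≤ 1 := by
  refine Finset.card_le_one.2 fun x hx y hy => ?_
  rw [Finset.mem_filter, mem_targetsFinset] at hx hy
  rcases s.targets_cases with h | h
  · have hx' := (isChild_or_isChild_of_adj hroot (h x hx.1)).resolve_left hx.2
    have hy' := (isChild_or_isChild_of_adj hroot (h y hy.1)).resolve_left hy.2
    exact hx'.parent_unique hroot hy'
  · have hx' : x = s.walker := by simpa [h] using hx.1
    have hy' : y = s.walker := by simpa [h] using hy.1
    rw [hx', hy']

open Classical in
lemma card_targets_grow_le (hroot : root ∈ s.tree.verts) :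
    s.grow.targetsFinset.card ≤
      2 * (s.grow.targetsFinset.filter fun y => s.grow.IsChild root s.walker y).card := by
  have hchild : 0 < (s.grow.targetsFinset.filter fun y => s.grow.IsChild root s.walker y).card := by
    have hnew := isChild_newVertex hroot
    refine Finset.card_pos.2 ⟨s.newVertex, Finset.mem_filter.2 ⟨?_, hnew⟩⟩
    exact mem_targetsFinset.2 (mem_targets_of_adj hnew.1)
  have hother := card_filter_not_isChild_targets_le_one (mem_verts_grow_of_mem hroot)
  have hsum := Finset.card_filter_add_card_filter_not (s := s.grow.targetsFinset)
    fun y => s.grow.IsChild root s.walker y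
  rw [walker_grow] at hother
  omega

end State

open State

section Kernels

variable {p : unitInterval} {s : State} {root : ℕ} {f : State → ℝ≥0∞}

lemma lintegral_jumpKernel (hf : Measurable f) (s : State) :
    ∫⁻ t, f t ∂jumpKernel s =
      (s.targetsFinset.card : ℝ≥0∞)⁻¹ * ∑ y ∈ s.targetsFinset, f (s.moveTo y) := by
  change ∫⁻ t, f t ∂(uniformOn s.targets).map s.moveTo = _
  have htargets : s.targets = (s.targetsFinset : Set ℕ) := by simp [targetsFinset]
  rw [lintegral_map hf (measurable_of_countable _), uniformOn, ProbabilityTheory.cond,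
    lintegral_smul_measure, htargets, Measure.count_apply_finset, lintegral_finset]
  simp

lemma lintegral_growKernel (hf : Measurable f) (p : unitInterval) (s : State) :
    ∫⁻ t, f t ∂growKernel p s = ENNReal.ofReal p * f s.grow + ENNReal.ofReal (1 - p) * f s := by
  change ∫⁻ t, f t ∂(ENNReal.ofReal p • Measure.dirac s.grow +
    ENNReal.ofReal (1 - p) • Measure.dirac s) = _
  rw [lintegral_add_measure, lintegral_smul_measure, lintegral_smul_measure,
    lintegral_dirac' _ hf, lintegral_dirac' _ hf]
  rfl

lemma lintegral_stepKernel (hf : Measurable f) (p : unitInterval) (s : State) :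
    ∫⁻ t, f t ∂stepKernel p s = ENNReal.ofReal p * ∫⁻ t, f t ∂jumpKernel s.grow +
      ENNReal.ofReal (1 - p) * ∫⁻ t, f t ∂jumpKernel s := by
  rw [stepKernel, Kernel.lintegral_comp _ _ _ hf, lintegral_growKernel hf.lintegral_kernel]

lemma lintegral_jumpKernel_le (hf : Measurable f) {B : ℕ → ℝ} {U : ℝ}
    (h : ∀ y ∈ s.targets, f (s.moveTo y) ≤ ENNReal.ofReal (B y)) (hB : ∀ y ∈ s.targets, 0 ≤ B y)
    (hU : ∑ y ∈ s.targetsFinset, B y ≤ s.targetsFinset.card * U) :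
    ∫⁻ t, f t ∂jumpKernel s ≤ ENNReal.ofReal U := by
  have hcard : (0 : ℝ) < s.targetsFinset.card := Nat.cast_pos.2 s.card_targetsFinset_pos
  rw [lintegral_jumpKernel hf]
  calc (s.targetsFinset.card : ℝ≥0∞)⁻¹ * ∑ y ∈ s.targetsFinset, f (s.moveTo y)
      ≤ (s.targetsFinset.card : ℝ≥0∞)⁻¹ * ∑ y ∈ s.targetsFinset, ENNReal.ofReal (B y) := by
        gcongr with y hy
        exact h y (mem_targetsFinset.1 hy)
    _ = ENNReal.ofReal ((s.targetsFinset.card : ℝ)⁻¹ * ∑ y ∈ s.targetsFinset, B y) := by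
        rw [ENNReal.ofReal_mul (by positivity), ENNReal.ofReal_inv_of_pos hcard,
          ENNReal.ofReal_natCast, ENNReal.ofReal_sum_of_nonneg]
        exact fun y hy => hB y (mem_targetsFinset.1 hy)
    _ ≤ ENNReal.ofReal U := ENNReal.ofReal_le_ofReal ((inv_mul_le_iff₀ hcard).2 hU)

lemma lintegral_stepKernel_le (hf : Measurable f) {U U₁ U₂ : ℝ}
    (h₁ : ∫⁻ t, f t ∂jumpKernel s.grow ≤ ENNReal.ofReal U₁)
    (h₂ : ∫⁻ t, f t ∂jumpKernel s ≤ ENNReal.ofReal U₂) (hU₁ : 0 ≤ U₁) (hU₂ : 0 ≤ U₂)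
    (hU : p * U₁ + (1 - p) * U₂ ≤ U) :
    ∫⁻ t, f t ∂stepKernel p s ≤ ENNReal.ofReal U := by
  have hp := p.2.1
  have hp' : 0 ≤ 1 - (p : ℝ) := sub_nonneg.2 p.2.2
  rw [lintegral_stepKernel hf]
  calc _ ≤ ENNReal.ofReal p * ENNReal.ofReal U₁ + ENNReal.ofReal (1 - p) * ENNReal.ofReal U₂ := by
        gcongr
    _ = ENNReal.ofReal (p * U₁ + (1 - p) * U₂) := by
        rw [ENNReal.ofReal_add (by positivity) (by positivity), ENNReal.ofReal_mul hp,
          ENNReal.ofReal_mul hp']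
    _ ≤ ENNReal.ofReal U := ENNReal.ofReal_le_ofReal hU

lemma ae_stepKernel_of_forall_targets {B : Set State} (hB : MeasurableSet B)
    (hgrow : ∀ y ∈ s.grow.targets, s.grow.moveTo y ∈ B) (hstay : ∀ y ∈ s.targets, s.moveTo y ∈ B) :
    ∀ᵐ t ∂stepKernel p s, t ∈ B := by
  have hind : Measurable (Bᶜ.indicator (1 : State → ℝ≥0∞)) := measurable_one.indicator hB.compl
  have hzero : ∀ t : State, (∀ y ∈ t.targets, t.moveTo y ∈ B) →
      ∑ y ∈ t.targetsFinset, Bᶜ.indicator (1 : State → ℝ≥0∞) (t.moveTo y) = 0 :=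
    fun t ht => Finset.sum_eq_zero fun y hy =>
      Set.indicator_of_notMem (not_not.2 (ht y (mem_targetsFinset.1 hy))) _
  rw [ae_iff]
  change stepKernel p s Bᶜ = 0
  rw [← lintegral_indicator_one hB.compl, lintegral_stepKernel hind, lintegral_jumpKernel hind,
    lintegral_jumpKernel hind, hzero _ hgrow, hzero _ hstay]
  simp only [mul_zero, add_zero]

lemma ae_stepKernel_root_mem_and_level_le (hroot : root ∈ s.tree.verts) :
    ∀ᵐ t ∂stepKernel p s, root ∈ t.tree.verts ∧ level root s ≤ level root t + 1 := by
  have hmeas : MeasurableSet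
      {t : State | root ∈ t.tree.verts ∧ level root s ≤ level root t + 1} :=
    (measurableSet_setOfPred.2 (measurable_mem root)).inter
      (measurableSet_le measurable_const ((measurable_level root).add_const 1))
  have hroot' := mem_verts_grow_of_mem hroot
  refine ae_stepKernel_of_forall_targets hmeas (fun y hy => ⟨?_, ?_⟩) fun y hy => ⟨?_, ?_⟩
  · rwa [tree_moveTo]
  · exact level_grow hroot ▸ level_le_level_moveTo_add_one hroot' hy
  · rwa [tree_moveTo]
  · exact level_le_level_moveTo_add_one hroot hy

open Classical in
lemma lintegral_jumpKernel_grow_le_of_isChild (hf : Measurable f) (hf1 : ∀ t, f t ≤ 1) {q : ℝ}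
    (hq : 0 ≤ q) (hq1 : q ≤ 1) (hroot : root ∈ s.tree.verts)
    (h : ∀ y, s.grow.IsChild root s.walker y →
      f (s.grow.moveTo y) ≤ ENNReal.ofReal (1 - q)) :
    ∫⁻ t, f t ∂jumpKernel s.grow ≤ ENNReal.ofReal (1 - q / 2) := by
  refine lintegral_jumpKernel_le hf
    (B := fun y => 1 - if s.grow.IsChild root s.walker y then q else 0) ?_ ?_ ?_
  · intro y _
    split_ifs with hy
    · exact h y hy
    · simpa using hf1 _
  · intro y _
    split_ifs <;> linarith
  · rw [Finset.sum_sub_distrib, ← Finset.sum_filter]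
    simp only [Finset.sum_const, nsmul_eq_mul, mul_one]
    have hcard : (s.grow.targetsFinset.card : ℝ) ≤
        2 * (s.grow.targetsFinset.filter fun y => s.grow.IsChild root s.walker y).card := by
      exact_mod_cast card_targets_grow_le hroot
    nlinarith

lemma lintegral_stepKernel_le_of_isChild (hf : Measurable f) (hf1 : ∀ t, f t ≤ 1) {q : ℝ}
    (hq : 0 ≤ q) (hq1 : q ≤ 1) (hroot : root ∈ s.tree.verts)
    (h : ∀ y, s.grow.IsChild root s.walker y →
      f (s.grow.moveTo y) ≤ ENNReal.ofReal (1 - q)) :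
    ∫⁻ t, f t ∂stepKernel p s ≤ ENNReal.ofReal (1 - p * q / 2) := by
  refine lintegral_stepKernel_le hf (U₂ := 1)
    (lintegral_jumpKernel_grow_le_of_isChild hf hf1 hq hq1 hroot h) ?_ (by linarith) zero_le_one
    (by linarith)
  rw [ENNReal.ofReal_one]
  exact lintegral_le_const (Eventually.of_forall hf1)

end Kernels

section FairRace

/-- The probability that a fair coin shows `h` heads before it shows `j` tails. -/
def fairRace : ℕ → ℕ → ℝ
  | 0, _ => 1
  | _ + 1, 0 => 0
  | h + 1, j + 1 => (fairRace h (j + 1) + fairRace (h + 1) j) / 2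

@[simp] lemma fairRace_zero_left (j : ℕ) : fairRace 0 j = 1 := by
  cases j <;> simp [fairRace]

@[simp] lemma fairRace_succ_zero (h : ℕ) : fairRace (h + 1) 0 = 0 := by simp [fairRace]

lemma fairRace_succ_succ (h j : ℕ) :
    fairRace (h + 1) (j + 1) = (fairRace h (j + 1) + fairRace (h + 1) j) / 2 := by
  simp [fairRace]

lemma fairRace_zero_right (h : ℕ) : fairRace h 0 = if h = 0 then 1 else 0 := by
  cases h <;> simp

lemma fairRace_nonneg (h j : ℕ) : 0 ≤ fairRace h j := by
  fun_induction fairRace h j <;> linarith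

lemma fairRace_le_one (h j : ℕ) : fairRace h j ≤ 1 := by
  fun_induction fairRace h j <;> linarith

lemma fairRace_succ_pos (h j : ℕ) : 0 < fairRace h (j + 1) := by
  induction h with
  | zero => simp
  | succ h ih =>
    rw [fairRace_succ_succ]
    linarith [fairRace_nonneg (h + 1) j]

lemma fairRace_add_swap (h j : ℕ) : fairRace (h + 1) j + fairRace j (h + 1) = 1 := by
  induction j generalizing h with
  | zero => simp
  | succ j ihj =>
    induction h with
    | zero =>
      rw [fairRace_succ_succ, fairRace_succ_succ, fairRace_zero_left, fairRace_succ_zero]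
      linarith [ihj 0]
    | succ h ih =>
      rw [fairRace_succ_succ (h + 1) j, fairRace_succ_succ j (h + 1)]
      linarith [ihj (h + 1)]

lemma fairRace_succ_self (h : ℕ) : fairRace (h + 1) (h + 1) = 1 / 2 := by
  linarith [fairRace_add_swap h (h + 1)]

lemma fairRace_sub_succ (h j : ℕ) :
    fairRace h (j + 1) - fairRace (h + 1) (j + 1) =
      ((h + j).choose h : ℝ) / 2 ^ (h + j + 1) := by
  induction h generalizing j with
  | zero =>
    induction j with
    | zero => norm_num [fairRace_succ_succ]
    | succ j ih =>
      simp only [fairRace_zero_left, Nat.choose_zero_right, Nat.cast_one, zero_add] at ih ⊢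
      rw [fairRace_succ_succ, fairRace_zero_left, pow_succ]
      field_simp at ih ⊢
      linarith
  | succ h ihh =>
    induction j with
    | zero =>
      have hleft := ihh 0
      rw [fairRace_succ_succ (h + 1) 0, fairRace_succ_zero]
      rw [fairRace_succ_succ h 0, fairRace_succ_zero] at hleft ⊢
      simp only [add_zero, Nat.choose_self, Nat.cast_one] at hleft ⊢
      rw [pow_succ]
      field_simp at hleft ⊢
      linarith
    | succ j ih =>
      have hleft := ihh (j + 1)
      have hpascal := Nat.choose_succ_succ (h + 1 + j) h
      rw [show h + (j + 1) = h + 1 + j by omega] at hleft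
      rw [fairRace_succ_succ h (j + 1), fairRace_succ_succ (h + 1) (j + 1),
        show h + 1 + (j + 1) = h + 1 + j + 1 by omega, hpascal, pow_succ]
      push_cast
      field_simp at hleft ih ⊢
      linarith

lemma centralBinom_sq_mul_le (m : ℕ) : m.centralBinom ^ 2 * (2 * m + 1) ≤ 16 ^ m := by
  induction m with
  | zero => simp
  | succ m ih =>
    have hsucc := Nat.succ_mul_centralBinom_succ m
    refine Nat.le_of_mul_le_mul_left ?_ (show 0 < (m + 1) ^ 2 by positivity)
    calc (m + 1) ^ 2 * ((m + 1).centralBinom ^ 2 * (2 * (m + 1) + 1))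
        = ((m + 1) * (m + 1).centralBinom) ^ 2 * (2 * m + 3) := by ring
      _ = m.centralBinom ^ 2 * (2 * m + 1) * (4 * ((2 * m + 1) * (2 * m + 3))) := by
          rw [hsucc]; ring
      _ ≤ 16 ^ m * (4 * (4 * (m + 1) ^ 2)) := by
          refine Nat.mul_le_mul ih ?_
          nlinarith
      _ = (m + 1) ^ 2 * 16 ^ (m + 1) := by ring

lemma choose_two_mul_add_one_le (m k : ℕ) : (2 * m + 1).choose k ≤ 2 * m.centralBinom := by
  cases k with
  | zero => simpa using Nat.le_trans (Nat.centralBinom_pos m) (by omega)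
  | succ k =>
    have hk := Nat.choose_le_centralBinom k m
    have hk' := Nat.choose_le_centralBinom (k + 1) m
    rw [Nat.choose_succ_succ, Nat.succ_eq_add_one]
    omega

lemma choose_sq_mul_le (n k : ℕ) : n.choose k ^ 2 * n ≤ 4 ^ n := by
  obtain ⟨m, rfl | rfl⟩ := Nat.even_or_odd' n
  · calc (2 * m).choose k ^ 2 * (2 * m) ≤ m.centralBinom ^ 2 * (2 * m + 1) := by
          gcongr
          · exact Nat.choose_le_centralBinom k m
          · omega
      _ ≤ 16 ^ m := centralBinom_sq_mul_le m
      _ = 4 ^ (2 * m) := by rw [pow_mul]; norm_num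
  · calc (2 * m + 1).choose k ^ 2 * (2 * m + 1) ≤ (2 * m.centralBinom) ^ 2 * (2 * m + 1) := by
          gcongr
          exact choose_two_mul_add_one_le m k
      _ = 4 * (m.centralBinom ^ 2 * (2 * m + 1)) := by ring
      _ ≤ 4 * 16 ^ m := by gcongr; exact centralBinom_sq_mul_le m
      _ = 4 ^ (2 * m + 1) := by rw [pow_succ, pow_mul]; norm_num; ring

lemma choose_div_two_pow_le {n : ℕ} {x : ℝ} (hx : 0 < x) (hn : x ^ 2 ≤ n) (k : ℕ) :
    (n.choose k : ℝ) / 2 ^ n ≤ 1 / x := by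
  rw [div_le_div_iff₀ (by positivity) hx, one_mul]
  refine le_of_sq_le_sq ?_ (by positivity)
  calc ((n.choose k : ℝ) * x) ^ 2 = (n.choose k : ℝ) ^ 2 * x ^ 2 := by ring
    _ ≤ (n.choose k : ℝ) ^ 2 * n := by gcongr
    _ ≤ 4 ^ n := by exact_mod_cast choose_sq_mul_le n k
    _ = (2 ^ n) ^ 2 := by rw [← pow_mul, mul_comm n 2, pow_mul]; norm_num

lemma half_sub_le_fairRace_add {e : ℕ} {x : ℝ} (hx : 0 < x) (hxe : x ^ 2 ≤ (2 * e + 1 : ℕ))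
    (i : ℕ) : 1 / 2 - i / (2 * x) ≤ fairRace (e + 1 + i) (e + 1) := by
  induction i with
  | zero => simp [fairRace_succ_self]
  | succ i ih =>
    have hstep := fairRace_sub_succ (e + 1 + i) e
    have hchoose : ((e + 1 + i + e).choose (e + 1 + i) : ℝ) / 2 ^ (e + 1 + i + e) ≤ 1 / x :=
      choose_div_two_pow_le hx (hxe.trans (Nat.cast_le.2 (by omega))) _
    rw [pow_succ, ← div_div] at hstep
    have hsplit : ((i + 1 : ℕ) : ℝ) / (2 * x) = i / (2 * x) + 1 / x / 2 := by
      push_cast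
      field_simp
    rw [hsplit, ← add_assoc]
    linarith

lemma quarter_le_fairRace {b : ℕ} (hb : 0 < b) :
    1 / 4 ≤ fairRace (4 * b ^ 2 + b) (4 * b ^ 2) := by
  obtain ⟨e, he⟩ := Nat.exists_eq_add_one_of_ne_zero (show 4 * b ^ 2 ≠ 0 by positivity)
  have hbe : (2 * (b : ℝ)) ^ 2 ≤ (2 * e + 1 : ℕ) := by
    have hle : (2 * b) ^ 2 ≤ 2 * e + 1 := by
      rw [mul_pow]
      omega
    exact_mod_cast hle
  have hdiv : (b : ℝ) / (2 * (2 * b)) = 1 / 4 := by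
    field_simp
    norm_num
  have hlead := half_sub_le_fairRace_add (by positivity) hbe b
  rw [he]
  linarith

end FairRace

section MonotoneAffine

/-- An affine function of one real variable with nonnegative slope. -/
def IsMonotoneAffine (f : ℝ → ℝ) : Prop := ∃ A B, 0 ≤ B ∧ ∀ z, f z = A + B * z

namespace IsMonotoneAffine

variable {ι : Type*} {T : Finset ι} {f g : ℝ → ℝ}

lemma const (A : ℝ) : IsMonotoneAffine fun _ => A := ⟨A, 0, le_rfl, fun _ => by simp⟩

lemma id : IsMonotoneAffine fun z => z := ⟨0, 1, zero_le_one, fun _ => by simp⟩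

lemma add (hf : IsMonotoneAffine f) (hg : IsMonotoneAffine g) :
    IsMonotoneAffine fun z => f z + g z := by
  obtain ⟨A, B, hB, hf⟩ := hf
  obtain ⟨A', B', hB', hg⟩ := hg
  exact ⟨A + A', B + B', add_nonneg hB hB', fun z => by simp only [hf, hg]; ring⟩

lemma sum {F : ι → ℝ → ℝ} (hF : ∀ i ∈ T, IsMonotoneAffine (F i)) :
    IsMonotoneAffine fun z => ∑ i ∈ T, F i z := by
  classical
  induction T using Finset.induction_on with
  | empty => simpa using const 0
  | insert i T hi ih =>
    simp only [Finset.sum_insert hi]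
    exact (hF i (Finset.mem_insert_self i T)).add
      (ih fun k hk => hF k (Finset.mem_insert_of_mem hk))

lemma const_mul (hf : IsMonotoneAffine f) {a : ℝ} (ha : 0 ≤ a) :
    IsMonotoneAffine fun z => a * f z := by
  obtain ⟨A, B, hB, hf⟩ := hf
  exact ⟨a * A, a * B, mul_nonneg ha hB, fun z => by simp only [hf]; ring⟩

lemma comp (hf : IsMonotoneAffine f) (hg : IsMonotoneAffine g) :
    IsMonotoneAffine fun z => f (g z) := by
  obtain ⟨A, B, hB, hf⟩ := hf
  obtain ⟨A', B', hB', hg⟩ := hg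
  exact ⟨A + B * A', B * B', mul_nonneg hB hB', fun z => by simp only [hf, hg]; ring⟩

lemma monotone (hf : IsMonotoneAffine f) : Monotone f := by
  obtain ⟨A, B, hB, hf⟩ := hf
  intro z z' hz
  rw [hf, hf]
  gcongr

lemma map_weightedMean (hf : IsMonotoneAffine f) (w z z' : ℝ) :
    f (w * z + (1 - w) * z') = w * f z + (1 - w) * f z' := by
  obtain ⟨A, B, _, hf⟩ := hf
  rw [hf, hf, hf]
  ring

lemma sum_map_eq (hf : IsMonotoneAffine f) {z : ι → ℝ} {U : ℝ}
    (hz : ∑ i ∈ T, z i = T.card * U) : ∑ i ∈ T, f (z i) = T.card * f U := by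
  obtain ⟨A, B, _, hf⟩ := hf
  simp only [hf, Finset.sum_add_distrib, ← Finset.mul_sum, hz, Finset.sum_const, nsmul_eq_mul]
  ring

end IsMonotoneAffine

end MonotoneAffine

section Race

open Finset

variable {ι : Type*} [DecidableEq ι] {M : ℕ} {S : Finset ι} {j : ℕ} {t t' : ι → ℕ} {y y' : ι → ℝ}

lemma sum_sub_update_lt {c : ι} (hc : c ∈ S) (hcM : t c < M) :
    ∑ c' ∈ S, (M - Function.update t c (t c + 1) c') < ∑ c' ∈ S, (M - t c') := by
  refine sum_lt_sum (fun c' _ => ?_) ⟨c, hc, ?_⟩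
  · rcases eq_or_ne c' c with rfl | hne
    · rw [Function.update_self]
      omega
    · rw [Function.update_of_ne hne]
  · rw [Function.update_self]
    omega

/-- The players are the elements of `S`, who start with the scores `t`, and one more player, the
parent. In each round a uniformly chosen player among the parent and the elements of `S` with a
score less than `M` scores. The race ends when the parent has scored `j` times; its value is the
expectation of the product of `y` over the players in `S` whose score is then `M`. -/
def race (M : ℕ) (S : Finset ι) (y : ι → ℝ) : ℕ → (ι → ℕ) → ℝ
  | 0, t => ∏ c ∈ S with M ≤ t c, y c
  | j + 1, t => (race M S y j t + ∑ c ∈ (S.filter fun c => t c < M).attach,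
      race M S y (j + 1) (Function.update t c (t c + 1))) / (#{c ∈ S | t c < M} + 1)
termination_by j t => j + ∑ c ∈ S, (M - t c)
decreasing_by
  · omega
  · have hc := mem_filter.1 c.2
    exact Nat.add_lt_add_left (sum_sub_update_lt hc.1 hc.2) _

lemma race_zero : race M S y 0 t = ∏ c ∈ S with M ≤ t c, y c := by rw [race]

lemma race_succ : race M S y (j + 1) t = (race M S y j t + ∑ c ∈ S with t c < M,
    race M S y (j + 1) (Function.update t c (t c + 1))) / (#{c ∈ S | t c < M} + 1) := by
  rw [race, sum_attach _ fun c => race M S y (j + 1) (Function.update t c (t c + 1))]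

@[elab_as_elim]
lemma race_induction {motive : ℕ → (ι → ℕ) → Prop} (M : ℕ) (S : Finset ι)
    (zero : ∀ t, motive 0 t)
    (succ : ∀ j t, motive j t → (∀ c ∈ S.filter fun c => t c < M,
      motive (j + 1) (Function.update t c (t c + 1))) → motive (j + 1) t)
    (j : ℕ) (t : ι → ℕ) : motive j t :=
  race.induct M S motive zero (fun j t hparent hplayer => succ j t hparent
    fun c hc => hplayer ⟨c, hc⟩) j t

lemma race_congr (ht : ∀ c ∈ S, t c = t' c) (hy : ∀ c ∈ S, y c = y' c) :
    race M S y j t = race M S y' j t' := by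
  induction j, t using race_induction M S generalizing t' with
  | zero t =>
    rw [race_zero, race_zero, filter_congr fun c hc => by rw [ht c hc]]
    exact prod_congr rfl fun c hc => hy c (mem_filter.1 hc).1
  | succ j t hparent hplayer =>
    have hactive : S.filter (fun c => t c < M) = S.filter (fun c => t' c < M) :=
      filter_congr fun c hc => by rw [ht c hc]
    rw [race_succ, race_succ, hparent ht, ← hactive]
    congr 2
    refine sum_congr rfl fun c hc => hplayer c hc fun c' hc' => ?_
    rw [ht c (mem_filter.1 hc).1]
    rcases eq_or_ne c' c with rfl | hne
    · simp
    · rw [Function.update_of_ne hne, Function.update_of_ne hne, ht c' hc']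

lemma race_nonneg (hy : ∀ c ∈ S, 0 ≤ y c) : 0 ≤ race M S y j t := by
  induction j, t using race_induction M S with
  | zero t =>
    rw [race_zero]
    exact prod_nonneg fun c hc => hy c (mem_filter.1 hc).1
  | succ j t hparent hplayer =>
    rw [race_succ]
    have hsum := sum_nonneg hplayer
    positivity

lemma race_mono (hy : ∀ c ∈ S, 0 ≤ y c) (hyy' : ∀ c ∈ S, y c ≤ y' c) :
    race M S y j t ≤ race M S y' j t := by
  induction j, t using race_induction M S with
  | zero t =>
    rw [race_zero, race_zero]
    exact prod_le_prod (fun c hc => hy c (mem_filter.1 hc).1) fun c hc => hyy' c (mem_filter.1 hc).1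
  | succ j t hparent hplayer =>
    rw [race_succ, race_succ]
    gcongr with c hc
    exact hplayer c hc

lemma isMonotoneAffine_race_update (hy : ∀ c ∈ S, 0 ≤ y c) (j : ℕ) (t : ι → ℕ) (v : ι) :
    IsMonotoneAffine fun z => race M S (Function.update y v z) j t := by
  induction j, t using race_induction M S with
  | zero t =>
    simp only [race_zero]
    by_cases hv : v ∈ S.filter fun c => M ≤ t c
    · simp only [prod_update_of_mem hv, mul_comm _ (∏ _ ∈ _, _)]
      exact .const_mul .id (prod_nonneg fun c hc => hy c (mem_filter.1 (mem_sdiff.1 hc).1).1)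
    · simp only [prod_update_of_notMem hv]
      exact .const _
  | succ j t hparent hplayer =>
    convert (hparent.add (.sum hplayer)).const_mul
      (inv_nonneg.2 (by positivity : (0 : ℝ) ≤ #{c ∈ S | t c < M} + 1)) using 2 with z
    rw [race_succ, div_eq_inv_mul]

lemma one_sub_pow_le {r : ℝ} {k : ℕ} (hr : 0 ≤ r) (hr1 : r ≤ 1) (hk : k * r ≤ 1) :
    (1 - r) ^ k ≤ 1 - r / 2 * k := by
  have hbernoulli : 1 + k * r ≤ (1 + r) ^ k := one_add_mul_le_pow (by linarith) k
  have hprod : (1 - r) ^ k * (1 + r) ^ k ≤ 1 := by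
    rw [← mul_pow]
    exact pow_le_one₀ (by nlinarith) (by nlinarith)
  have hkr : 0 ≤ (k : ℝ) * r := by positivity
  have hmul : (1 - r) ^ k * (1 + k * r) ≤ 1 :=
    (mul_le_mul_of_nonneg_left hbernoulli (pow_nonneg (by linarith) k)).trans hprod
  nlinarith

omit [DecidableEq ι] in
lemma sum_fairRace_zero_right :
    ∑ c ∈ S, fairRace (M - t c) 0 = #{c ∈ S | M ≤ t c} := by
  simp only [fairRace_zero_right, Nat.sub_eq_zero_iff_le, sum_boole]

/-- Seen only by one player of `S` and the parent, the race is a fair one. -/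
lemma sum_fairRace_update_add (c : ι) (j : ℕ) (hc : c ∈ S) :
    ∑ x ∈ S with t x < M, fairRace (M - Function.update t x (t x + 1) c) (j + 1) +
        fairRace (M - t c) j =
      (#{x ∈ S | t x < M} + 1) * fairRace (M - t c) (j + 1) := by
  set active := S.filter fun x => t x < M
  have hother : ∀ x ∈ active.erase c,
      fairRace (M - Function.update t x (t x + 1) c) (j + 1) = fairRace (M - t c) (j + 1) :=
    fun x hx => by rw [Function.update_of_ne (ne_of_mem_erase hx).symm]
  by_cases hcM : t c < M
  · have hca : c ∈ active := mem_filter.2 ⟨hc, hcM⟩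
    obtain ⟨k, hk⟩ := Nat.exists_eq_add_one_of_ne_zero (Nat.sub_ne_zero_of_lt hcM)
    rw [← add_sum_erase _ _ hca, sum_congr rfl hother, sum_const, card_erase_of_mem hca,
      nsmul_eq_mul, Nat.cast_sub (card_pos.2 ⟨c, hca⟩), Function.update_self,
      show M - (t c + 1) = k by omega, hk, fairRace_succ_succ]
    push_cast
    ring
  · have hca : c ∉ active := fun h => hcM (mem_filter.1 h).2
    rw [erase_eq_of_notMem hca] at hother
    rw [sum_congr rfl hother, show M - t c = 0 by omega]
    simp

lemma race_const_le {r : ℝ} (hr : 0 ≤ r) (hr1 : r ≤ 1) (hS : #S * r ≤ 1) :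
    race M S (fun _ => 1 - r) j t ≤ 1 - r / 2 * ∑ c ∈ S, fairRace (M - t c) j := by
  induction j, t using race_induction M S with
  | zero t =>
    rw [race_zero, prod_const, sum_fairRace_zero_right]
    refine one_sub_pow_le hr hr1 (le_trans ?_ hS)
    gcongr
    exact filter_subset _ _
  | succ j t hparent hplayer =>
    have hsum := sum_le_sum hplayer
    have hfair := sum_congr rfl fun c hc =>
      sum_fairRace_update_add (M := M) (S := S) (t := t) c j hc
    rw [sum_add_distrib, sum_comm, ← mul_sum] at hfair
    rw [sum_sub_distrib, sum_const, nsmul_eq_mul, mul_one, ← mul_sum] at hsum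
    rw [race_succ, div_le_iff₀ (by positivity)]
    linear_combination hparent + hsum - r / 2 * hfair

/-- The value of the race after the draw of `x`, when the parent `w` still had to score `j + 1`
times. Nobody scores if `x` is neither `w` nor an element of `S` with a score less than `M`. -/
def raceOutcome (M : ℕ) (S : Finset ι) (y : ι → ℝ) (j : ℕ) (t : ι → ℕ) (w x : ι) : ℝ :=
  if x = w then race M S y j t
  else if x ∈ S ∧ t x < M then race M S y (j + 1) (Function.update t x (t x + 1))
  else race M S y (j + 1) t

lemma raceOutcome_nonneg (hy : ∀ c ∈ S, 0 ≤ y c) (w x : ι) :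
    0 ≤ raceOutcome M S y j t w x := by
  unfold raceOutcome
  split_ifs <;> exact race_nonneg hy

lemma sum_raceOutcome {T : Finset ι} {w : ι} (hw : w ∈ T) (hwS : w ∉ S) (hST : S ⊆ T) :
    ∑ x ∈ T, raceOutcome M S y j t w x = #T * race M S y (j + 1) t := by
  set active := S.filter fun c => t c < M
  have hwa : w ∉ active := fun h => hwS (mem_filter.1 h).1
  have hactive : ∀ x ∈ active, raceOutcome M S y j t w x =
      race M S y (j + 1) (Function.update t x (t x + 1)) := fun x hx => by
    rw [raceOutcome, if_neg (ne_of_mem_of_not_mem hx hwa), if_pos (mem_filter.1 hx)]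
  have hidle : ∀ x ∈ T, x ∉ insert w active →
      raceOutcome M S y j t w x - race M S y (j + 1) t = 0 := fun x _ hx => by
    rw [mem_insert, not_or, mem_filter] at hx
    rw [raceOutcome, if_neg hx.1, if_neg hx.2, sub_self]
  have hsum := sum_subset (insert_subset hw ((filter_subset _ _).trans hST)) hidle
  rw [sum_insert hwa, sum_sub_distrib, sum_sub_distrib, sum_congr rfl hactive, sum_const,
    sum_const, nsmul_eq_mul, nsmul_eq_mul, raceOutcome, if_pos rfl] at hsum
  have hrace : race M S y (j + 1) t * (#active + 1) = race M S y j t +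
      ∑ c ∈ active, race M S y (j + 1) (Function.update t c (t c + 1)) := by
    rw [race_succ, div_mul_cancel₀ _ (by positivity)]
  linear_combination -hrace - hsum

end Race

/-- The constants of the bookkeeping. The first `cap` entries into a vertex from its parent are
recorded. During the first `warmup` of them only the birth of children is recorded, and afterwards
the recorded children race against the parent. The number `escape` bounds from below the probability
that one of the first `cap` visits to a new vertex never ends. -/
structure Scheme (p : unitInterval) where
  cap : ℕ
  warmup : ℕ
  escape : ℝ
  warmup_lt_cap : warmup < cap
  escape_pos : 0 < escape
  escape_le_one : escape ≤ 1
  warmup_mul_escape_le_one : warmup * escape ≤ 1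
  two_le_gain : 2 ≤ fairRace cap (cap - warmup) * (p * warmup)

lemma nonempty_scheme {p : unitInterval} (hp : 0 < p) : Nonempty (Scheme p) := by
  have hp' : (0 : ℝ) < p := hp
  obtain ⟨n, hn⟩ := exists_nat_ge (8 / (p : ℝ))
  have hwarmup : 8 ≤ p * ((n + 1 : ℕ) : ℝ) := by
    rw [div_le_iff₀ hp'] at hn
    push_cast
    nlinarith
  refine ⟨⟨4 * (n + 1) ^ 2 + (n + 1), n + 1, 1 / ((n + 1 : ℕ) : ℝ),
    Nat.lt_add_of_pos_left (by positivity), by positivity, ?_, ?_, ?_⟩⟩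
  · rw [div_le_one (by positivity)]
    exact_mod_cast n.succ_pos
  · exact (mul_one_div_cancel (by positivity)).le
  · rw [Nat.add_sub_cancel]
    nlinarith [quarter_le_fairRace n.succ_pos]

/-- The record of the past which the value of a path is computed from: the number of entries into
each vertex from its parent, the recorded children of each vertex, and a bound on the probability
that all remaining visits to a vertex end. -/
structure Ledger where
  entries : ℕ → ℕ
  recorded : ℕ → Finset ℕ
  value : ℕ → ℝ

namespace Ledger

/-- The ledger after the bound at `v` has been changed to `z`. -/
@[simps]
def setValue (L : Ledger) (v : ℕ) (z : ℝ) : Ledger :=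
  { L with value := Function.update L.value v z }

/-- The ledger after an entry into `c`. -/
@[simps]
def recordEntry (L : Ledger) (c : ℕ) : Ledger :=
  { L with entries := Function.update L.entries c (L.entries c + 1) }

/-- The ledger after the birth of a child `c` of `v`. -/
@[simps]
def recordChild (L : Ledger) (v c : ℕ) : Ledger :=
  { L with recorded := Function.update L.recorded v (insert c (L.recorded v)) }

variable {L : Ledger} {c u v x : ℕ} {z : ℝ}

lemma value_setValue_of_ne (h : x ≠ v) : (L.setValue v z).value x = L.value x :=
  Function.update_of_ne h _ _

lemma value_setValue_nonneg (hL : ∀ u, 0 ≤ L.value u) (hz : 0 ≤ z) (v u : ℕ) :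
    0 ≤ (L.setValue v z).value u := by
  rw [setValue_value, Function.update_apply]
  split_ifs
  exacts [hz, hL u]

lemma entries_recordEntry_self : (L.recordEntry c).entries c = L.entries c + 1 :=
  Function.update_self _ _ _

lemma entries_recordEntry_of_ne (h : x ≠ c) : (L.recordEntry c).entries x = L.entries x :=
  Function.update_of_ne h _ _

lemma entries_le_entries_recordEntry (c x : ℕ) : L.entries x ≤ (L.recordEntry c).entries x := by
  rcases eq_or_ne x c with rfl | h
  · rw [entries_recordEntry_self]
    exact Nat.le_succ _
  · rw [entries_recordEntry_of_ne h]

lemma recorded_recordChild_self : (L.recordChild v c).recorded v = insert c (L.recorded v) :=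
  Function.update_self _ _ _

lemma recorded_recordChild_of_ne (h : x ≠ v) : (L.recordChild v c).recorded x = L.recorded x :=
  Function.update_of_ne h _ _

lemma mem_recorded_recordChild :
    x ∈ (L.recordChild v c).recorded u ↔ x ∈ L.recorded u ∨ (u = v ∧ x = c) := by
  rcases eq_or_ne u v with rfl | h
  · simp [or_comm]
  · simp [h]

/-- Agreement of two ledgers on all that the value of the vertex `v` depends on. -/
structure AgreesAt (L L' : Ledger) (v : ℕ) : Prop where
  entries_eq : L.entries v = L'.entries v
  recorded_eq : L.recorded v = L'.recorded v
  entries_eq_of_mem : ∀ c ∈ L.recorded v, L.entries c = L'.entries c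
  value_eq_of_mem : ∀ c ∈ L.recorded v, L.value c = L'.value c

lemma agreesAt_setValue (h : v ∉ L.recorded u) : (L.setValue v z).AgreesAt L u :=
  ⟨rfl, rfl, fun _ _ => rfl, fun _ hc => value_setValue_of_ne (ne_of_mem_of_not_mem hc h)⟩

lemma agreesAt_recordEntry (hu : u ≠ c) (h : c ∉ L.recorded u) :
    (L.recordEntry c).AgreesAt L u :=
  ⟨entries_recordEntry_of_ne hu, rfl,
    fun _ hx => entries_recordEntry_of_ne (ne_of_mem_of_not_mem hx h), fun _ _ => rfl⟩

lemma agreesAt_recordChild (hu : u ≠ v) : (L.recordChild v c).AgreesAt L u :=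
  ⟨rfl, recorded_recordChild_of_ne hu, fun _ _ => rfl, fun _ _ => rfl⟩

end Ledger

namespace Scheme

variable {p : unitInterval} {P : Scheme p} {L L' : Ledger} {k n t u v : ℕ} {rest : List ℕ} {z : ℝ}

/-- The value of a vertex with `n` recorded children which has been entered `t ≤ warmup` times: to
first order, the probability that no recorded child ends the race by a visit without end, where the
children still to be born are counted with their expected number. -/
def warmupValue (P : Scheme p) (t n : ℕ) : ℝ :=
  1 - P.escape / 2 * fairRace P.cap (P.cap - P.warmup) * (n + p * (P.warmup - t))

/-- The bound which the ledger yields on the probability that all remaining visits to `v` end. Here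
`k = 1` if a visit to `v` is in progress and `k = 0` otherwise, so that after the warm-up
`cap - entries v + k` exits from `v` remain. -/
def vertexValue (P : Scheme p) (L : Ledger) (k v : ℕ) : ℝ :=
  if L.entries v ≤ P.warmup then P.warmupValue (L.entries v) (L.recorded v).card
  else race P.cap (L.recorded v) L.value (P.cap - L.entries v + k) L.entries

/-- The value of the last vertex of a path all of whose vertices are being visited, as a function
of the value `z` of the first one. -/
def pathValue (P : Scheme p) (L : Ledger) : ℕ → List ℕ → ℝ → ℝ
  | _, [], z => z
  | v, u :: rest, z => P.pathValue L u rest (P.vertexValue (L.setValue v z) 1 u)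

lemma warmupValue_nonneg (hn : n ≤ t) (ht : t ≤ P.warmup) : 0 ≤ P.warmupValue t n := by
  have hn' : (n : ℝ) ≤ t := Nat.cast_le.2 hn
  have ht' : (t : ℝ) ≤ P.warmup := Nat.cast_le.2 ht
  have hp := mul_le_mul_of_nonneg_right p.2.2 (sub_nonneg.2 ht')
  have hp' := mul_nonneg p.2.1 (sub_nonneg.2 ht')
  have hchildren : fairRace P.cap (P.cap - P.warmup) * (n + p * (P.warmup - t)) ≤ P.warmup :=
    (mul_le_of_le_one_left (by positivity) (fairRace_le_one _ _)).trans (by linarith)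
  have hescape := mul_le_mul_of_nonneg_left hchildren P.escape_pos.le
  unfold warmupValue
  linarith [P.warmup_mul_escape_le_one]

lemma warmupValue_zero_le (P : Scheme p) : P.warmupValue 0 0 ≤ 1 - P.escape := by
  have hgain := mul_le_mul_of_nonneg_left P.two_le_gain P.escape_pos.le
  unfold warmupValue
  push_cast
  linarith

lemma warmupValue_eq_mean (P : Scheme p) (t n : ℕ) : P.warmupValue t n =
    p * P.warmupValue (t + 1) (n + 1) + (1 - p) * P.warmupValue (t + 1) n := by
  unfold warmupValue
  push_cast
  ring

lemma vertexValue_of_le_warmup (h : L.entries v ≤ P.warmup) :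
    P.vertexValue L k v = P.warmupValue (L.entries v) (L.recorded v).card := if_pos h

lemma vertexValue_of_warmup_lt (h : P.warmup < L.entries v) : P.vertexValue L k v =
    race P.cap (L.recorded v) L.value (P.cap - L.entries v + k) L.entries := if_neg h.not_ge

lemma vertexValue_congr (h : L.AgreesAt L' v) : P.vertexValue L k v = P.vertexValue L' k v := by
  unfold vertexValue
  rw [← h.entries_eq, ← h.recorded_eq, race_congr h.entries_eq_of_mem h.value_eq_of_mem]

lemma pathValue_congr (h : ∀ u ∈ rest, L.AgreesAt L' u) (v : ℕ) (z : ℝ) :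
    P.pathValue L v rest z = P.pathValue L' v rest z := by
  induction rest generalizing v z with
  | nil => rfl
  | cons u rest ih =>
    rw [pathValue, pathValue, ih fun u hu => h u (List.mem_cons_of_mem _ hu)]
    have hu := h u List.mem_cons_self
    congr 1
    refine vertexValue_congr ⟨hu.entries_eq, hu.recorded_eq, hu.entries_eq_of_mem, fun c hc => ?_⟩
    simp only [Ledger.setValue_value, Function.update_apply, hu.value_eq_of_mem c hc]

lemma vertexValue_nonneg (hcard : L.entries v ≤ P.warmup → (L.recorded v).card ≤ L.entries v)
    (hL : ∀ u, 0 ≤ L.value u) (k : ℕ) : 0 ≤ P.vertexValue L k v := by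
  unfold vertexValue
  split_ifs with hv
  · exact warmupValue_nonneg (hcard hv) hv
  · exact race_nonneg fun c _ => hL c

lemma pathValue_nonneg (hcard : ∀ u, L.entries u ≤ P.warmup → (L.recorded u).card ≤ L.entries u)
    (hL : ∀ u, 0 ≤ L.value u) (hz : 0 ≤ z) (v : ℕ) (rest : List ℕ) :
    0 ≤ P.pathValue L v rest z := by
  induction rest generalizing v z with
  | nil => exact hz
  | cons u _ ih =>
    exact ih (vertexValue_nonneg (L := L.setValue v z) (hcard u)
      (Ledger.value_setValue_nonneg hL hz v) 1) u

lemma isMonotoneAffine_vertexValue_setValue (hL : ∀ u, 0 ≤ L.value u) (k v u : ℕ) :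
    IsMonotoneAffine fun z => P.vertexValue (L.setValue v z) k u := by
  by_cases h : L.entries u ≤ P.warmup
  · simp only [vertexValue, Ledger.setValue_entries, Ledger.setValue_recorded, if_pos h]
    exact .const _
  · simp only [vertexValue, Ledger.setValue_entries, Ledger.setValue_recorded, if_neg h]
    exact isMonotoneAffine_race_update (fun c _ => hL c) _ _ v

lemma isMonotoneAffine_pathValue (hL : ∀ u, 0 ≤ L.value u) (v : ℕ) (rest : List ℕ) :
    IsMonotoneAffine (P.pathValue L v rest) := by
  induction rest generalizing v with
  | nil => exact .id
  | cons u rest ih => exact (ih u).comp (isMonotoneAffine_vertexValue_setValue hL 1 v u)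

end Scheme

section Tracking

/-- The ledger `L` fits the tree of the state `s` rooted at `root`, and nothing but births of
children has been recorded at vertices which are still in their warm-up. -/
structure Ledger.Consistent (L : Ledger) {p : unitInterval} (P : Scheme p) (root : ℕ) (s : State) :
    Prop where
  root_mem : root ∈ s.tree.verts
  isChild : ∀ u, ∀ c ∈ L.recorded u, s.IsChild root u c
  fresh : ∀ u, L.entries u ≤ P.warmup → ∀ c ∈ L.recorded u,
    L.entries c = 0 ∧ L.value c = 1 - P.escape
  card_le : ∀ u, L.entries u ≤ P.warmup → (L.recorded u).card ≤ L.entries u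
  value_nonneg : ∀ u, 0 ≤ L.value u
  entries_le : ∀ u, L.entries u ≤ P.cap
  unused : ∀ u, u ∉ s.tree.verts → L.entries u = 0 ∧ L.recorded u = ∅ ∧ L.value u = 1 - P.escape

variable {p : unitInterval} {P : Scheme p} {root j : ℕ} {s : State} {L : Ledger} {c u v x y : ℕ}
  {rest : List ℕ} {z : ℝ}

namespace Ledger.Consistent

lemma dist_eq (h : L.Consistent P root s) (hc : c ∈ L.recorded u) :
    s.dist c root = s.dist u root + 1 := (h.isChild u c hc).2

lemma mem_verts (h : L.Consistent P root s) (hc : c ∈ L.recorded u) : c ∈ s.tree.verts :=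
  s.tree.edge_vert (h.isChild u c hc).1.symm

lemma eq_of_mem_recorded (h : L.Consistent P root s) (hu : c ∈ L.recorded u)
    (hv : c ∈ L.recorded v) : u = v :=
  (h.isChild u c hu).parent_unique h.root_mem (h.isChild v c hv)

lemma ne_of_mem_recorded (h : L.Consistent P root s) (hc : c ∈ L.recorded u) : c ≠ u := by
  rintro rfl
  exact absurd (h.dist_eq hc) (Nat.succ_ne_self _).symm

lemma dist_lt_of_isChain (h : L.Consistent P root s)
    (hchain : (v :: rest).IsChain fun a u => a ∈ L.recorded u) :
    ∀ u ∈ rest, s.dist u root < s.dist v root := by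
  have hdist : (v :: rest).IsChain fun a u => s.dist u root < s.dist a root :=
    hchain.imp fun _ _ hau => (Nat.lt_succ_self _).trans_eq (h.dist_eq hau).symm
  have : IsTrans ℕ fun a u => s.dist u root < s.dist a root := ⟨fun _ _ _ h h' => h'.trans h⟩
  exact (List.pairwise_cons.1 hdist.pairwise).1

lemma notMem_recorded_of_isChain (h : L.Consistent P root s)
    (hchain : (u :: rest).IsChain fun a u => a ∈ L.recorded u) (hc : c ∈ L.recorded u)
    (hx : x ∈ rest) : c ∉ L.recorded x := fun hcx =>
  (h.dist_lt_of_isChain hchain x hx).ne (by rw [h.eq_of_mem_recorded hcx hc])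

lemma vertexValue_nonneg (h : L.Consistent P root s) (k v : ℕ) : 0 ≤ P.vertexValue L k v :=
  Scheme.vertexValue_nonneg (h.card_le v) h.value_nonneg k

lemma pathValue_nonneg (h : L.Consistent P root s) (hz : 0 ≤ z) (v : ℕ) (rest : List ℕ) :
    0 ≤ P.pathValue L v rest z :=
  Scheme.pathValue_nonneg h.card_le h.value_nonneg hz v rest

lemma grow (h : L.Consistent P root s) : L.Consistent P root s.grow where
  root_mem := State.mem_verts_grow_of_mem h.root_mem
  isChild u c hc := (h.isChild u c hc).grow h.root_mem
  fresh := h.fresh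
  card_le := h.card_le
  value_nonneg := h.value_nonneg
  entries_le := h.entries_le
  unused u hu := h.unused u fun hu' => hu (State.mem_verts_grow_of_mem hu')

lemma moveTo (h : L.Consistent P root s) (y : ℕ) : L.Consistent P root (s.moveTo y) where
  root_mem := by simpa only [State.tree_moveTo] using h.root_mem
  isChild u c hc := by simpa only [State.isChild_moveTo] using h.isChild u c hc
  fresh := h.fresh
  card_le := h.card_le
  value_nonneg := h.value_nonneg
  entries_le := h.entries_le
  unused := by simpa only [State.tree_moveTo] using h.unused

lemma setValue (h : L.Consistent P root s) (hv : v ∈ L.recorded u) (hu : P.warmup < L.entries u)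
    (hz : 0 ≤ z) : (L.setValue v z).Consistent P root s where
  root_mem := h.root_mem
  isChild := h.isChild
  fresh a ha c hc := by
    have hcv : c ≠ v := by
      rintro rfl
      exact (h.eq_of_mem_recorded hc hv ▸ ha).not_gt hu
    exact (h.fresh a ha c hc).imp_right (value_setValue_of_ne hcv).trans
  card_le := h.card_le
  value_nonneg := value_setValue_nonneg h.value_nonneg hz v
  entries_le := h.entries_le
  unused x hx := by
    have hxv : x ≠ v := fun hxv => hx (hxv ▸ h.mem_verts hv)
    exact (h.unused x hx).imp_right (.imp_right (value_setValue_of_ne hxv).trans)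

lemma recordEntry (h : L.Consistent P root s) (hc : c ∈ L.recorded v)
    (hv : P.warmup < L.entries v) (hcap : L.entries c < P.cap) :
    (L.recordEntry c).Consistent P root s where
  root_mem := h.root_mem
  isChild := h.isChild
  fresh a ha x hx := by
    have ha' := (entries_le_entries_recordEntry c a).trans ha
    have hxc : x ≠ c := by
      rintro rfl
      exact (h.eq_of_mem_recorded hx hc ▸ ha').not_gt hv
    exact (h.fresh a ha' x hx).imp_left (entries_recordEntry_of_ne hxc).trans
  card_le a ha := (h.card_le a ((entries_le_entries_recordEntry c a).trans ha)).trans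
    (entries_le_entries_recordEntry c a)
  value_nonneg := h.value_nonneg
  entries_le a := by
    rcases eq_or_ne a c with rfl | hac
    · exact entries_recordEntry_self.trans_le hcap
    · exact (entries_recordEntry_of_ne hac).trans_le (h.entries_le a)
  unused x hx := by
    have hxc : x ≠ c := fun hxc => hx (hxc ▸ h.mem_verts hc)
    exact (h.unused x hx).imp_left (entries_recordEntry_of_ne hxc).trans

lemma recordChild (h : L.Consistent P root s) (hcard : (L.recorded s.walker).card <
    L.entries s.walker) : (L.recordChild s.walker s.newVertex).Consistent P root s.grow where
  root_mem := h.grow.root_mem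
  isChild u c hc := by
    rcases mem_recorded_recordChild.1 hc with hc | ⟨rfl, rfl⟩
    · exact h.grow.isChild u c hc
    · exact State.isChild_newVertex h.root_mem
  fresh u hu c hc := by
    rcases mem_recorded_recordChild.1 hc with hc | ⟨rfl, rfl⟩
    · exact h.fresh u hu c hc
    · exact (h.unused _ s.newVertex_notMem).imp_right And.right
  card_le u hu := by
    rcases eq_or_ne u s.walker with rfl | huw
    · rw [recorded_recordChild_self]
      exact (Finset.card_insert_le _ _).trans hcard
    · rw [recorded_recordChild_of_ne huw]
      exact h.card_le u hu
  value_nonneg := h.value_nonneg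
  entries_le := h.entries_le
  unused x hx := by
    have hxw : x ≠ s.walker := fun hxw => hx (hxw ▸ s.grow.walker_mem)
    rw [recorded_recordChild_of_ne hxw]
    exact h.grow.unused x hx

lemma race_le_vertexValue (h : L.Consistent P root s) (hc : L.entries c = P.warmup) :
    race P.cap (L.recorded c) L.value (P.cap - P.warmup) L.entries ≤ P.vertexValue L 0 c := by
  have hfresh := h.fresh c hc.le
  have hcard : ((L.recorded c).card : ℝ) * P.escape ≤ 1 := by
    have hle : ((L.recorded c).card : ℝ) ≤ P.warmup := Nat.cast_le.2 (hc ▸ h.card_le c hc.le)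
    exact (mul_le_mul_of_nonneg_right hle P.escape_pos.le).trans P.warmup_mul_escape_le_one
  rw [race_congr (t' := fun _ => 0) (y' := fun _ => 1 - P.escape) (fun x hx => (hfresh x hx).1)
    fun x hx => (hfresh x hx).2]
  refine (race_const_le P.escape_pos.le P.escape_le_one hcard).trans_eq ?_
  rw [Scheme.vertexValue_of_le_warmup hc.le, hc, Scheme.warmupValue, Finset.sum_const,
    nsmul_eq_mul, Nat.sub_zero]
  ring

lemma vertexValue_recordEntry_le (h : L.Consistent P root s) (hwarm : P.warmup ≤ L.entries c)
    (hcap : L.entries c < P.cap) : P.vertexValue (L.recordEntry c) 1 c ≤ P.vertexValue L 0 c := by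
  have hentries : ∀ x ∈ L.recorded c, (L.recordEntry c).entries x = L.entries x :=
    fun x hx => entries_recordEntry_of_ne (h.ne_of_mem_recorded hx)
  rw [Scheme.vertexValue_of_warmup_lt (by rw [entries_recordEntry_self]; omega),
    entries_recordEntry_self, show P.cap - (L.entries c + 1) + 1 = P.cap - L.entries c by omega,
    recordEntry_recorded, race_congr hentries fun _ _ => rfl]
  rcases hwarm.eq_or_lt with heq | hlt
  · exact heq ▸ h.race_le_vertexValue heq.symm
  · exact (Scheme.vertexValue_of_warmup_lt (L := L) (k := 0) hlt).ge

end Ledger.Consistent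

/-- The state `s` is tracked by the ledger `L` along the path `v :: rest`: visits to its vertices,
and to no others, are in progress, the vertices being listed upwards from the deepest one, `v`, to
one at level `j + 1` whose last recorded visit is the present one. -/
structure Tracks (P : Scheme p) (root j : ℕ) (s : State) (L : Ledger) (v : ℕ) (rest : List ℕ) :
    Prop extends L.Consistent P root s where
  awayValue_le : ∀ c, c ∉ v :: rest → P.vertexValue L 0 c ≤ L.value c
  value_eq_one : ∀ c, c ∉ v :: rest → L.entries c = P.cap → L.value c = 1
  isChain : (v :: rest).IsChain fun a u => a ∈ L.recorded u
  warm : ∀ u ∈ rest, P.warmup < L.entries u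
  last : ∃ u ∈ (v :: rest).getLast?, L.entries u = P.cap ∧ s.dist u root = j + 1
  isDescendant : s.IsDescendant root v s.walker

namespace Tracks

lemma dist_lt (h : Tracks P root j s L v rest) : ∀ u ∈ rest, s.dist u root < s.dist v root :=
  h.dist_lt_of_isChain h.isChain

lemma notMem_rest (h : Tracks P root j s L v rest) : v ∉ rest := fun hv => (h.dist_lt v hv).ne rfl

lemma notMem_of_mem_recorded (h : Tracks P root j s L v rest) (hc : c ∈ L.recorded v) :
    c ∉ v :: rest := by
  have hdist := h.dist_eq hc
  rw [List.mem_cons]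
  rintro (rfl | hmem)
  · omega
  · have hlt := h.dist_lt c hmem
    omega

lemma lt_level (h : Tracks P root j s L v rest) : j < State.level root s := by
  obtain ⟨u, hu, -, hdist⟩ := h.last
  refine lt_of_lt_of_le ?_ h.isDescendant.dist_le
  rcases List.mem_cons.1 (List.mem_of_getLast? hu) with rfl | hmem
  · omega
  · exact (by omega : j < s.dist u root).trans (h.dist_lt u hmem)

lemma vertexValue_eq_one (h : Tracks P root j s L v rest) (hv : L.entries v = P.cap) :
    P.vertexValue L 0 v = 1 := by
  rw [Scheme.vertexValue_of_warmup_lt (hv ▸ P.warmup_lt_cap), hv, Nat.sub_self, race_zero]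
  refine Finset.prod_eq_one fun c hc => ?_
  rw [Finset.mem_filter] at hc
  exact h.value_eq_one c (h.notMem_of_mem_recorded hc.1) (le_antisymm (h.entries_le c) hc.2)

lemma grow (h : Tracks P root j s L v rest) : Tracks P root j s.grow L v rest where
  toConsistent := h.toConsistent.grow
  awayValue_le := h.awayValue_le
  value_eq_one := h.value_eq_one
  isChain := h.isChain
  warm := h.warm
  last := by
    obtain ⟨u, hu, hcap, hdist⟩ := h.last
    have hmem : u ∈ s.tree.verts := by
      by_contra hmem
      have hentries := (h.unused u hmem).1
      have hlt := P.warmup_lt_cap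
      omega
    exact ⟨u, hu, hcap, (State.dist_grow hmem h.root_mem).trans hdist⟩
  isDescendant := h.isDescendant.grow h.root_mem

lemma moveTo (h : Tracks P root j s L v rest) (hy : y ∈ s.targets)
    (hvy : s.IsDescendant root v y) : Tracks P root j (s.moveTo y) L v rest where
  toConsistent := h.toConsistent.moveTo y
  awayValue_le := h.awayValue_le
  value_eq_one := h.value_eq_one
  isChain := h.isChain
  warm := h.warm
  last := by simpa only [State.dist_moveTo] using h.last
  isDescendant := by
    rwa [State.walker_moveTo_of_mem_targets hy, State.isDescendant_moveTo]

lemma exit (h : Tracks P root j s L v (u :: rest)) (hu : u ∈ s.targets) :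
    Tracks P root j (s.moveTo u) (L.setValue v (P.vertexValue L 0 v)) u rest := by
  obtain ⟨hv, hchain⟩ := List.isChain_cons_cons.1 h.isChain
  refine ⟨(h.setValue hv (h.warm u List.mem_cons_self) (h.vertexValue_nonneg 0 v)).moveTo u,
    fun c hc => ?_, fun c hc hcap => ?_, hchain, fun x hx => h.warm x (List.mem_cons_of_mem _ hx),
    ?_, ?_⟩
  · have hvc : v ∉ L.recorded c := fun hvc =>
      hc (h.eq_of_mem_recorded hvc hv ▸ List.mem_cons_self)
    rw [Scheme.vertexValue_congr (Ledger.agreesAt_setValue hvc)]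
    rcases eq_or_ne c v with rfl | hcv
    · rw [Ledger.setValue_value, Function.update_self]
    · rw [Ledger.value_setValue_of_ne hcv]
      exact h.awayValue_le c fun hmem => (List.mem_cons.1 hmem).elim hcv hc
  · rcases eq_or_ne c v with rfl | hcv
    · rw [Ledger.setValue_value, Function.update_self, h.vertexValue_eq_one hcap]
    · rw [Ledger.value_setValue_of_ne hcv]
      exact h.value_eq_one c (fun hmem => (List.mem_cons.1 hmem).elim hcv hc) hcap
  · simpa only [State.dist_moveTo, Ledger.setValue_entries, List.getLast?_cons_cons] using h.last
  · rw [State.walker_moveTo_of_mem_targets hu]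
    exact .refl

lemma pathValue_exit (h : Tracks P root j s L v (u :: rest)) (z : ℝ) :
    P.pathValue (L.setValue v z) u rest (P.vertexValue (L.setValue v z) 1 u) =
      P.pathValue L v (u :: rest) z := by
  obtain ⟨hv, hchain⟩ := List.isChain_cons_cons.1 h.isChain
  exact Scheme.pathValue_congr
    (fun x hx => Ledger.agreesAt_setValue (h.notMem_recorded_of_isChain hchain hv hx)) _ _

lemma enter (h : Tracks P root j s L v rest) (hc : c ∈ L.recorded v) (hcap : L.entries c < P.cap)
    (hv : P.warmup < L.entries v) (hct : c ∈ s.targets) :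
    Tracks P root j (s.moveTo c) (L.recordEntry c) c (v :: rest) := by
  have hc' := h.notMem_of_mem_recorded hc
  have hne : ∀ x ∈ v :: rest, x ≠ c := fun x hx => ne_of_mem_of_not_mem hx hc'
  refine ⟨(h.recordEntry hc hv hcap).moveTo c, fun x hx => ?_, fun x hx hxcap => ?_,
    List.isChain_cons_cons.2 ⟨hc, h.isChain⟩, fun x hx => ?_, ?_, ?_⟩
  · rw [List.mem_cons, not_or] at hx
    have hcx : c ∉ L.recorded x := fun hcx =>
      hx.2 (h.eq_of_mem_recorded hcx hc ▸ List.mem_cons_self)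
    rw [Scheme.vertexValue_congr (Ledger.agreesAt_recordEntry hx.1 hcx)]
    exact h.awayValue_le x hx.2
  · rw [List.mem_cons, not_or] at hx
    rw [Ledger.entries_recordEntry_of_ne hx.1] at hxcap
    exact h.value_eq_one x hx.2 hxcap
  · rw [Ledger.entries_recordEntry_of_ne (hne x hx)]
    rcases List.mem_cons.1 hx with rfl | hx
    exacts [hv, h.warm x hx]
  · obtain ⟨w, hw, hwcap, hdist⟩ := h.last
    refine ⟨w, by rwa [List.getLast?_cons_cons], ?_, by rwa [State.dist_moveTo]⟩
    rwa [Ledger.entries_recordEntry_of_ne (hne w (List.mem_of_getLast? hw))]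
  · rw [State.walker_moveTo_of_mem_targets hct]
    exact .refl

lemma pathValue_enter_le (h : Tracks P root j s L v rest) (hc : c ∈ L.recorded v)
    (hv : P.warmup < L.entries v) (hz0 : 0 ≤ z) (hz : z ≤ L.value c) :
    P.pathValue (L.recordEntry c) c (v :: rest) z ≤
      P.pathValue L v rest (race P.cap (L.recorded v) L.value (P.cap - L.entries v + 1)
        (Function.update L.entries c (L.entries c + 1))) := by
  have hc' := h.notMem_of_mem_recorded hc
  rw [List.mem_cons, not_or] at hc'
  rw [Scheme.pathValue, Scheme.pathValue_congr fun x hx => Ledger.agreesAt_recordEntry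
    (ne_of_mem_of_not_mem hx hc'.2) (h.notMem_recorded_of_isChain h.isChain hc hx)]
  refine (Scheme.isMonotoneAffine_pathValue h.value_nonneg v rest).monotone ?_
  have hentries : ((L.recordEntry c).setValue c z).entries v = L.entries v :=
    Ledger.entries_recordEntry_of_ne (Ne.symm hc'.1)
  rw [Scheme.vertexValue_of_warmup_lt (hentries ▸ hv), hentries]
  refine race_mono (fun x _ => Ledger.value_setValue_nonneg (L := L.recordEntry c)
    h.value_nonneg hz0 c x) fun x _ => ?_
  rcases eq_or_ne x c with rfl | hxc
  · rwa [Ledger.setValue_value, Function.update_self]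
  · exact (Ledger.value_setValue_of_ne hxc).le

lemma recordChild (h : Tracks P root j s L s.walker rest)
    (hcard : (L.recorded s.walker).card < L.entries s.walker) :
    Tracks P root j s.grow (L.recordChild s.walker s.newVertex) s.walker rest where
  toConsistent := h.toConsistent.recordChild hcard
  awayValue_le c hc := by
    have hcw : c ≠ s.walker := fun hcw => hc (hcw ▸ List.mem_cons_self)
    rw [Scheme.vertexValue_congr (Ledger.agreesAt_recordChild hcw)]
    exact h.awayValue_le c hc
  value_eq_one := h.value_eq_one
  isChain := h.isChain.imp fun a u hau => Ledger.mem_recorded_recordChild.2 (Or.inl hau)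
  warm := h.warm
  last := h.grow.last
  isDescendant := h.grow.isDescendant

lemma pathValue_recordChild (h : Tracks P root j s L v rest) (c : ℕ) (z : ℝ) :
    P.pathValue (L.recordChild v c) v rest z = P.pathValue L v rest z :=
  Scheme.pathValue_congr
    (fun _ hx => Ledger.agreesAt_recordChild (ne_of_mem_of_not_mem hx h.notMem_rest)) v z

end Tracks

end Tracking

section Descent

/-- The probability that the level of the walker is at most `j` at one of the times `0, …, n`. -/
abbrev descentProb (p : unitInterval) (root j n : ℕ) (s : State) : ℝ≥0∞ :=
  hitProb (stepKernel p) {t | State.level root t ≤ j} n s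

variable {p : unitInterval} {P : Scheme p} {root j n : ℕ} {s : State} {L : Ledger} {a c v w y : ℕ}
  {rest : List ℕ}

lemma measurable_descentProb (p : unitInterval) (root j n : ℕ) :
    Measurable (descentProb p root j n) :=
  measurable_hitProb (measurableSet_le (State.measurable_level root) measurable_const) n

lemma descentProb_zero (h : j < State.level root s) : descentProb p root j 0 s = 0 :=
  hitProb_zero_of_notMem h.not_ge

lemma descentProb_succ (h : j < State.level root s) :
    descentProb p root j (n + 1) s = ∫⁻ t, descentProb p root j n t ∂stepKernel p s :=
  hitProb_succ_of_notMem (A := {t | State.level root t ≤ j}) h.not_ge n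

lemma lintegral_jumpKernel_le_of_forall_targets {f : State → ℝ≥0∞} (hf : Measurable f) {U : ℝ}
    (hU : 0 ≤ U) (h : ∀ y ∈ s.targets, f (s.moveTo y) ≤ ENNReal.ofReal U) :
    ∫⁻ t, f t ∂jumpKernel s ≤ ENNReal.ofReal U :=
  lintegral_jumpKernel_le hf h (fun _ _ => hU) (by rw [Finset.sum_const, nsmul_eq_mul])

lemma State.eq_or_isChild_of_mem_targets (hroot : root ∈ s.tree.verts)
    (hw : s.IsChild root w s.walker) (hy : y ∈ s.targets) :
    y = w ∨ s.IsChild root s.walker y := by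
  rcases isChild_or_isChild_of_adj hroot ((mem_targets_iff_of_adj hw.1.symm).1 hy) with h | h
  · exact Or.inr h
  · exact Or.inl (h.parent_unique hroot hw)

/-- In the course of a visit, the value of the path bounds the probability of a descent below its
last vertex within `n` steps. -/
def VisitBound (P : Scheme p) (n : ℕ) : Prop :=
  ∀ (root j : ℕ) (s : State) (L : Ledger) (v : ℕ) (rest : List ℕ), Tracks P root j s L v rest →
    descentProb p root j n s ≤ ENNReal.ofReal (P.pathValue L v rest (P.vertexValue L 1 v))

/-- The sharper form of `VisitBound` at the time of an entry during the warm-up, when the present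
visit may still begin with the birth of a child. -/
def EntryBound (P : Scheme p) (n : ℕ) : Prop :=
  ∀ (root j : ℕ) (s : State) (L : Ledger) (v : ℕ) (rest : List ℕ) (t : ℕ),
    Tracks P root j s L v rest → s.walker = v → L.entries v = t + 1 → t < P.warmup →
    (L.recorded v).card ≤ t →
    descentProb p root j n s ≤
      ENNReal.ofReal (P.pathValue L v rest (P.warmupValue t (L.recorded v).card))

lemma descentProb_moveTo_le_of_enter (hvisit : VisitBound P n) (hentry : EntryBound P n)
    (h : Tracks P root j s L v rest) (hc : c ∈ L.recorded v) (hcap : L.entries c < P.cap)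
    (hv : P.warmup < L.entries v) (hct : c ∈ s.targets) :
    descentProb p root j n (s.moveTo c) ≤ ENNReal.ofReal (P.pathValue L v rest
      (race P.cap (L.recorded v) L.value (P.cap - L.entries v + 1)
        (Function.update L.entries c (L.entries c + 1)))) := by
  have henter := h.enter hc hcap hv hct
  have haway := h.awayValue_le c (h.notMem_of_mem_recorded hc)
  rcases le_or_gt P.warmup (L.entries c) with hwarm | hwarm
  · exact (hvisit root j _ _ _ _ henter).trans (ENNReal.ofReal_le_ofReal
      (h.pathValue_enter_le hc hv (henter.vertexValue_nonneg 1 c)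
        ((h.vertexValue_recordEntry_le hwarm hcap).trans haway)))
  · have hcard := h.card_le c hwarm.le
    rw [Scheme.vertexValue_of_le_warmup hwarm.le] at haway
    exact (hentry root j _ _ _ _ (L.entries c) henter (State.walker_moveTo_of_mem_targets hct)
      Ledger.entries_recordEntry_self hwarm hcard).trans (ENNReal.ofReal_le_ofReal
        (h.pathValue_enter_le hc hv (Scheme.warmupValue_nonneg hcard hwarm.le) haway))

lemma descentProb_moveTo_le_of_exit (hvisit : VisitBound P n) (h : Tracks P root j s L v rest)
    (hw : s.IsChild root w v) (hwt : w ∈ s.targets) :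
    descentProb p root j n (s.moveTo w) ≤
      ENNReal.ofReal (P.pathValue L v rest (P.vertexValue L 0 v)) := by
  cases rest with
  | nil =>
    obtain ⟨u, hu, hcap, -⟩ := h.last
    obtain rfl : v = u := Option.some.inj hu
    rw [Scheme.pathValue, h.vertexValue_eq_one hcap, ENNReal.ofReal_one]
    exact hitProb_le_one n _
  | cons u rest =>
    have hv := (List.isChain_cons_cons.1 h.isChain).1
    obtain rfl : w = u := hw.parent_unique h.root_mem (h.isChild u v hv)
    rw [← h.pathValue_exit]
    exact hvisit root j _ _ _ _ (h.exit hwt)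

namespace Tracks

lemma exists_isChild_walker (h : Tracks P root j s L v rest) : ∃ w, s.IsChild root w s.walker :=
  State.exists_isChild h.root_mem s.walker_mem (Nat.ne_zero_of_lt h.lt_level)

lemma lintegral_jumpKernel_le_of_walker_ne (h : Tracks P root j s L v rest)
    (hvisit : VisitBound P n) (hne : s.walker ≠ v) :
    ∫⁻ t, descentProb p root j n t ∂jumpKernel s ≤
      ENNReal.ofReal (P.pathValue L v rest (P.vertexValue L 1 v)) := by
  obtain ⟨w, hw⟩ := h.exists_isChild_walker
  refine lintegral_jumpKernel_le_of_forall_targets (measurable_descentProb p root j n)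
    (h.pathValue_nonneg (h.vertexValue_nonneg 1 v) v rest) fun y hy =>
    hvisit root j _ _ _ _ (h.moveTo hy ?_)
  rcases State.eq_or_isChild_of_mem_targets h.root_mem hw hy with rfl | hy
  · exact h.isDescendant.parent h.root_mem hne hw
  · exact h.isDescendant.tail hy

lemma lintegral_jumpKernel_le_of_le_warmup (h : Tracks P root j s L s.walker rest)
    (hvisit : VisitBound P n) (hwarm : L.entries s.walker ≤ P.warmup) :
    ∫⁻ t, descentProb p root j n t ∂jumpKernel s ≤
      ENNReal.ofReal (P.pathValue L s.walker rest (P.vertexValue L 1 s.walker)) := by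
  obtain ⟨w, hw⟩ := h.exists_isChild_walker
  refine lintegral_jumpKernel_le_of_forall_targets (measurable_descentProb p root j n)
    (h.pathValue_nonneg (h.vertexValue_nonneg 1 _) _ rest) fun y hy => ?_
  rcases State.eq_or_isChild_of_mem_targets h.root_mem hw hy with rfl | hy'
  · have hexit := descentProb_moveTo_le_of_exit hvisit h hw hy
    rwa [Scheme.vertexValue_of_le_warmup hwarm] at hexit ⊢
  · exact hvisit root j _ _ _ _ (h.moveTo hy (.single hy'))

lemma lintegral_jumpKernel_le_of_warmup_lt (h : Tracks P root j s L s.walker rest)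
    (hvisit : VisitBound P n) (hentry : EntryBound P n) (hwarm : P.warmup < L.entries s.walker) :
    ∫⁻ t, descentProb p root j n t ∂jumpKernel s ≤
      ENNReal.ofReal (P.pathValue L s.walker rest (P.vertexValue L 1 s.walker)) := by
  obtain ⟨w, hw⟩ := h.exists_isChild_walker
  have hwT : w ∈ s.targetsFinset := State.mem_targetsFinset.2 (State.mem_targets_of_adj hw.1.symm)
  have hwS : w ∉ L.recorded s.walker := fun hmem => by
    have hdist := h.dist_eq hmem
    have hdist' := hw.2
    omega
  have hST : L.recorded s.walker ⊆ s.targetsFinset := fun c hc =>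
    State.mem_targetsFinset.2 (State.mem_targets_of_adj (h.isChild _ c hc).1)
  have hvalue := Scheme.vertexValue_of_warmup_lt (k := 1) hwarm
  refine lintegral_jumpKernel_le (measurable_descentProb p root j n)
    (B := fun y => P.pathValue L s.walker rest (raceOutcome P.cap (L.recorded s.walker) L.value
      (P.cap - L.entries s.walker) L.entries w y)) (fun y hy => ?_)
    (fun y _ => h.pathValue_nonneg (raceOutcome_nonneg (fun c _ => h.value_nonneg c) w y) _ rest)
    ((Scheme.isMonotoneAffine_pathValue h.value_nonneg _ rest).sum_map_eq
      (hvalue ▸ sum_raceOutcome hwT hwS hST)).le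
  unfold raceOutcome
  split_ifs with hyw hyS
  · subst hyw
    exact Scheme.vertexValue_of_warmup_lt (k := 0) hwarm ▸
      descentProb_moveTo_le_of_exit hvisit h hw hy
  · exact descentProb_moveTo_le_of_enter hvisit hentry h hyS.1 hyS.2 hwarm hy
  · have hy' := (State.eq_or_isChild_of_mem_targets h.root_mem hw hy).resolve_left hyw
    exact hvalue ▸ hvisit root j _ _ _ _ (h.moveTo hy (.single hy'))

lemma lintegral_jumpKernel_le (h : Tracks P root j s L v rest) (hvisit : VisitBound P n)
    (hentry : EntryBound P n) :
    ∫⁻ t, descentProb p root j n t ∂jumpKernel s ≤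
      ENNReal.ofReal (P.pathValue L v rest (P.vertexValue L 1 v)) := by
  rcases ne_or_eq s.walker v with hne | rfl
  · exact h.lintegral_jumpKernel_le_of_walker_ne hvisit hne
  · rcases le_or_gt (L.entries s.walker) P.warmup with hwarm | hwarm
    · exact h.lintegral_jumpKernel_le_of_le_warmup hvisit hwarm
    · exact h.lintegral_jumpKernel_le_of_warmup_lt hvisit hentry hwarm

end Tracks

lemma VisitBound.succ (hvisit : VisitBound P n) (hentry : EntryBound P n) :
    VisitBound P (n + 1) := by
  intro root j s L v rest h
  have hnonneg := h.pathValue_nonneg (h.vertexValue_nonneg 1 v) v rest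
  rw [descentProb_succ h.lt_level]
  exact lintegral_stepKernel_le (measurable_descentProb p root j n)
    (h.grow.lintegral_jumpKernel_le hvisit hentry) (h.lintegral_jumpKernel_le hvisit hentry)
    hnonneg hnonneg (by linarith)

lemma EntryBound.succ (hvisit : VisitBound P n) (hentry : EntryBound P n) :
    EntryBound P (n + 1) := by
  rintro root j s L v rest t h rfl ht htw hcard
  have hchild := h.recordChild (ht ▸ Nat.lt_succ_of_le hcard)
  have hstay : P.vertexValue L 1 s.walker =
      P.warmupValue (t + 1) (L.recorded s.walker).card := by
    rw [Scheme.vertexValue_of_le_warmup (ht.trans_le htw), ht]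
  have hborn : P.vertexValue (L.recordChild s.walker s.newVertex) 1 s.walker =
      P.warmupValue (t + 1) ((L.recorded s.walker).card + 1) := by
    have hnew : s.newVertex ∉ L.recorded s.walker := fun hmem =>
      s.newVertex_notMem (h.mem_verts hmem)
    rw [Scheme.vertexValue_of_le_warmup (L := L.recordChild _ _) (ht.trans_le htw),
      Ledger.recorded_recordChild_self, Finset.card_insert_of_notMem hnew,
      Ledger.recordChild_entries, ht]
  rw [descentProb_succ h.lt_level]
  refine lintegral_stepKernel_le (measurable_descentProb p root j n)
    (hchild.lintegral_jumpKernel_le hvisit hentry) (h.lintegral_jumpKernel_le hvisit hentry)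
    (hchild.pathValue_nonneg (hchild.vertexValue_nonneg 1 _) _ rest)
    (h.pathValue_nonneg (h.vertexValue_nonneg 1 _) _ rest) (le_of_eq ?_)
  rw [h.pathValue_recordChild, hstay, hborn, P.warmupValue_eq_mean t,
    (Scheme.isMonotoneAffine_pathValue h.value_nonneg _ rest).map_weightedMean]

lemma visitBound_and_entryBound (P : Scheme p) (n : ℕ) : VisitBound P n ∧ EntryBound P n := by
  induction n with
  | zero =>
    constructor
    · intro root j s L v rest h
      simp only [descentProb_zero h.lt_level, zero_le]
    · intro root j s L v rest t h
      simp only [descentProb_zero h.lt_level, zero_le, implies_true]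
  | succ n ih => exact ⟨ih.1.succ ih.2, .succ ih.1 ih.2⟩

/-- The ledger at the start: only `c` is recorded as a child of `a`, whose last recorded visit is in
progress. -/
def Ledger.initial (P : Scheme p) (a c : ℕ) : Ledger where
  entries := Function.update (fun _ => 0) a P.cap
  recorded := Function.update (fun _ => ∅) a {c}
  value _ := 1 - P.escape

/-- A lower bound for the probability that, from a child, the walker never gets to a vertex above
the parent of this child. -/
def Scheme.childEscape (P : Scheme p) : ℝ := P.escape / 2 * fairRace P.cap 1

lemma Scheme.childEscape_pos (P : Scheme p) : 0 < P.childEscape :=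
  mul_pos (half_pos P.escape_pos) (fairRace_succ_pos P.cap 0)

lemma Scheme.childEscape_le_one (P : Scheme p) : P.childEscape ≤ 1 :=
  mul_le_one₀ (by linarith [P.escape_le_one, P.escape_pos]) (fairRace_nonneg P.cap 1)
    (fairRace_le_one P.cap 1)

namespace Ledger

variable {x : ℕ}

lemma entries_initial_self : (initial P a c).entries a = P.cap := by
  simp only [initial, Function.update_self]

lemma recorded_initial_self : (initial P a c).recorded a = {c} := by
  simp only [initial, Function.update_self]

lemma entries_initial_of_ne (h : x ≠ a) : (initial P a c).entries x = 0 := by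
  simp only [initial, Function.update_of_ne h]

lemma recorded_initial_of_ne (h : x ≠ a) : (initial P a c).recorded x = ∅ := by
  simp only [initial, Function.update_of_ne h]

lemma recorded_initial_of_le_warmup (h : (initial P a c).entries x ≤ P.warmup) :
    (initial P a c).recorded x = ∅ := by
  refine recorded_initial_of_ne fun hxa => h.not_gt ?_
  rw [hxa, entries_initial_self]
  exact P.warmup_lt_cap

lemma consistent_initial (hroot : root ∈ s.tree.verts) (hc : s.IsChild root a c) :
    (initial P a c).Consistent P root s where
  root_mem := hroot
  isChild u x hx := by
    rcases eq_or_ne u a with rfl | hu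
    · rw [recorded_initial_self, Finset.mem_singleton] at hx
      exact hx ▸ hc
    · rw [recorded_initial_of_ne hu] at hx
      exact absurd hx (Finset.notMem_empty x)
  fresh u hu x hx := by
    rw [recorded_initial_of_le_warmup hu] at hx
    exact absurd hx (Finset.notMem_empty x)
  card_le u hu := by
    rw [recorded_initial_of_le_warmup hu]
    exact Nat.zero_le _
  value_nonneg _ := sub_nonneg.2 P.escape_le_one
  entries_le u := by
    rcases eq_or_ne u a with rfl | hu
    · exact entries_initial_self.le
    · exact (entries_initial_of_ne hu).trans_le (Nat.zero_le _)
  unused u hu := by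
    have hua : u ≠ a := fun hua => hu (hua ▸ s.tree.edge_vert hc.1)
    exact ⟨entries_initial_of_ne hua, recorded_initial_of_ne hua, rfl⟩

lemma tracks_initial (hroot : root ∈ s.tree.verts) (hc : s.IsChild root a s.walker)
    (ha : s.dist a root = j + 1) : Tracks P root j s (initial P a s.walker) a [] where
  toConsistent := consistent_initial hroot hc
  awayValue_le x hx := by
    have hxa := List.ne_of_not_mem_cons hx
    rw [Scheme.vertexValue_of_le_warmup ((entries_initial_of_ne hxa).trans_le (Nat.zero_le _)),
      entries_initial_of_ne hxa, recorded_initial_of_ne hxa]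
    exact P.warmupValue_zero_le
  value_eq_one x hx hcap := by
    rw [entries_initial_of_ne (List.ne_of_not_mem_cons hx)] at hcap
    exact absurd hcap (Nat.ne_zero_of_lt P.warmup_lt_cap).symm
  isChain := .singleton a
  warm _ hu := absurd hu List.not_mem_nil
  last := ⟨a, rfl, entries_initial_self, ha⟩
  isDescendant := .single hc

end Ledger

lemma descentProb_le_of_isChild (P : Scheme p) (n : ℕ) (hroot : root ∈ s.tree.verts)
    (hc : s.IsChild root a s.walker) (ha : s.dist a root = j + 1) :
    descentProb p root j n s ≤ ENNReal.ofReal (1 - P.childEscape) := by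
  have h := Ledger.tracks_initial (P := P) hroot hc ha
  refine ((visitBound_and_entryBound P n).1 _ _ _ _ _ _ h).trans (ENNReal.ofReal_le_ofReal ?_)
  have hne : s.walker ≠ a := h.ne_of_mem_recorded
    (Ledger.recorded_initial_self ▸ Finset.mem_singleton_self _)
  have hcard : (({s.walker} : Finset ℕ).card : ℝ) * P.escape ≤ 1 := by
    simpa using P.escape_le_one
  rw [Scheme.pathValue,
    Scheme.vertexValue_of_warmup_lt (P.warmup_lt_cap.trans_eq Ledger.entries_initial_self.symm),
    Ledger.entries_initial_self, Ledger.recorded_initial_self, Nat.sub_self, zero_add]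
  refine (race_const_le P.escape_pos.le P.escape_le_one hcard).trans_eq ?_
  rw [Finset.sum_singleton, Ledger.entries_initial_of_ne hne, Nat.sub_zero, Scheme.childEscape]

lemma descentProb_le (P : Scheme p) (n : ℕ) (hroot : root ∈ s.tree.verts)
    (hs : State.level root s = j + 1) :
    descentProb p root j n s ≤ ENNReal.ofReal (1 - p * P.childEscape / 2) := by
  have hlt : j < State.level root s := hs ▸ Nat.lt_succ_self j
  cases n with
  | zero => simp only [descentProb_zero hlt, zero_le]
  | succ n =>
    rw [descentProb_succ hlt]
    refine lintegral_stepKernel_le_of_isChild (measurable_descentProb p root j n)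
      (hitProb_le_one n) P.childEscape_pos.le P.childEscape_le_one hroot fun y hy => ?_
    have hwalker := State.walker_moveTo_of_mem_targets (State.mem_targets_of_adj hy.1)
    refine descentProb_le_of_isChild P n (a := s.walker) ?_ ?_ ?_
    · simpa only [State.tree_moveTo] using State.mem_verts_grow_of_mem hroot
    · rwa [hwalker, State.isChild_moveTo]
    · rw [State.dist_moveTo]
      exact (State.level_grow hroot).trans hs

lemma lintegral_descentProb_level_le (P : Scheme p) (n : ℕ) (hroot : root ∈ s.tree.verts) :
    ∫⁻ t, descentProb p root (State.level root s) n t ∂stepKernel p s ≤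
      ENNReal.ofReal (1 - p * (p * P.childEscape / 2) / 2) := by
  have hp := p.2.1
  have hp1 := p.2.2
  have hpos := P.childEscape_pos
  have hle := P.childEscape_le_one
  refine lintegral_stepKernel_le_of_isChild (measurable_descentProb p root _ n)
    (hitProb_le_one n) (by positivity) (by nlinarith) hroot fun y hy => descentProb_le P n ?_ ?_
  · simpa only [State.tree_moveTo] using State.mem_verts_grow_of_mem hroot
  · have hwalker := State.walker_moveTo_of_mem_targets (State.mem_targets_of_adj hy.1)
    rw [State.level, hwalker, State.dist_moveTo, hy.2]
    exact congrArg (· + 1) (State.level_grow hroot)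

lemma escapesUniformly_stepKernel (hp : 0 < p) (P : Scheme p) (root : ℕ) :
    EscapesUniformly (stepKernel p) {s | root ∈ s.tree.verts} (State.level root)
      (p * P.childEscape / 2) (p * (p * P.childEscape / 2) / 2) where
  measurable_level := State.measurable_level root
  q_pos := by
    have hp' : (0 : ℝ) < p := hp
    have hpos := P.childEscape_pos
    positivity
  q_le_one := by linarith [mul_le_one₀ p.2.2 P.childEscape_pos.le P.childEscape_le_one]
  ε_pos := by
    have hp' : (0 : ℝ) < p := hp
    have hpos := P.childEscape_pos
    positivity
  ε_le_one := by
    have hq := mul_le_one₀ p.2.2 P.childEscape_pos.le P.childEscape_le_one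
    have hq0 := mul_nonneg p.2.1 P.childEscape_pos.le
    linarith [mul_le_one₀ (b := p * P.childEscape / 2) p.2.2 (by linarith) (by linarith)]
  ae_mem_and_level_le _ hroot := ae_stepKernel_root_mem_and_level_le hroot
  hitProb_le _ hroot _ n hs := descentProb_le P n hroot hs
  lintegral_hitProb_le _ hroot n := lintegral_descentProb_level_le P n hroot

end Descent

end BGRW

end

theorem mainTheorem5 (p : unitInterval) (hp : 0 < p) :
    ∃ c : ℝ, 0 < c ∧ ∀ (s : BGRW.State) (root : ℕ), root ∈ s.tree.verts →
      ∀ᵐ ω ∂(BGRW.law p s),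
        (c : EReal) ≤ liminf
          (fun n : ℕ => ((((ω n).dist (ω n).walker root : ℝ) / (n : ℝ) : ℝ) : EReal)) atTop := by
  obtain ⟨P⟩ := BGRW.nonempty_scheme hp
  have hescape := BGRW.escapesUniformly_stepKernel hp P
  exact ⟨_, (hescape 0).escapeSpeed_pos,
    fun s root hroot => (hescape root).ae_escapeSpeed_le_liminf hroot⟩
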